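/- Let $(R,\mathfrak m,k)$ be a commutative noetherian local ring. Let $\mathsf D^f(R)$ be the full triangulated subcategory of the derived category $\mathsf D(R)$ of $R$-modules consisting of the complexes $X$ whose total cohomology $\bigoplus_{i\in\mathbb Z}H^i(X)$ is a finitely generated $R$-module, let $\mathsf{perf}(R)\subseteq \mathsf D^f(R)$ be the full subcategory of complexes isomorphic in $\mathsf D(R)$ to a bounded complex of finitely generated projective $R$-modules, and let $\mathsf D_{\mathsf{sg}}(R)=\mathsf D^f(R)/\mathsf{perf}(R)$ be the Verdier quotient (the singularity category of $R$). For an object $X$ of a triangulated category $\mathcal T$, let $\mathrm{thick}_{\mathcal T}(X)$ denote the smallest full subcategory of $\mathcal T$ that contains $X$ and is closed under shifts, cones and direct summands. Say that $R$ has an isolated singularity if the local ring $R_{\mathfrak p}$ is regular for every prime ideal $\mathfrak p\neq\mathfrak m$ (so $R$ itself may be regular). Then $R$ has an isolated singularity if and only if $$\mathsf D_{\mathsf{sg}}(R)=\mathrm{thick}_{\mathsf D_{\mathsf{sg}}(R)}(k).$$ -/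

import Mathlib

open CategoryTheory CategoryTheory.Limits CategoryTheory.Pretriangulated
open scoped DirectSum ZeroObject

universe w u

namespace SingularityCategory

section FiniteTotalCohomology

variable (R : Type u) [CommRing R] [HasDerivedCategory.{w} (ModuleCat.{u} R)]

/-- The `i`-th cohomology module of an object of the derived category `D(R)`. -/
noncomputable abbrev cohomology (X : DerivedCategory (ModuleCat.{u} R)) (i : ℤ) : ModuleCat.{u} R :=
  (DerivedCategory.homologyFunctor (ModuleCat.{u} R) i).obj X

/-- The objects of `D(R)` whose total cohomology `⨁ i, Hⁱ(X)` is a finitely generated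
`R`-module, i.e. the objects of `D^f(R)`. -/
def finiteCohomology : ObjectProperty (DerivedCategory (ModuleCat.{u} R)) :=
  fun X => Module.Finite R (⨁ i : ℤ, cohomology R X i)

instance : (finiteCohomology R).IsClosedUnderIsomorphisms where
  of_iso {X Y} e hX := by
    have : Module.Finite R (⨁ i : ℤ, cohomology R X i) := hX
    let E : (⨁ i : ℤ, cohomology R X i) ≃ₗ[R] (⨁ i : ℤ, cohomology R Y i) :=
      DFinsupp.mapRange.linearEquiv
        (fun i => ((DerivedCategory.homologyFunctor (ModuleCat.{u} R) i).mapIso e).toLinearEquiv)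
    exact Module.Finite.equiv E

instance : (finiteCohomology R).IsStableUnderShift ℤ where
  isStableUnderShiftBy a :=
    { le_shift := by
        intro X hX
        have : Module.Finite R (⨁ i : ℤ, cohomology R X i) := hX
        have e (i : ℤ) : cohomology R X ((Equiv.subRight a).symm i) ≅ cohomology R (X⟦a⟧) i :=
          (((DerivedCategory.homologyFunctor (ModuleCat.{u} R) 0).shiftIso a i (i + a)
            (add_comm a i)).app X).symm
        let E₁ : (⨁ i : ℤ, cohomology R X i) ≃ₗ[R]
            (⨁ i : ℤ, cohomology R X ((Equiv.subRight a).symm i)) :=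
          DirectSum.lequivCongrLeft R (Equiv.subRight a)
        let E₂ : (⨁ i : ℤ, cohomology R X ((Equiv.subRight a).symm i)) ≃ₗ[R]
            (⨁ i : ℤ, cohomology R (X⟦a⟧) i) :=
          DFinsupp.mapRange.linearEquiv (fun i => (e i).toLinearEquiv)
        exact Module.Finite.equiv (E₁.trans E₂) }

/-- Objects concentrated in degree `0` with finitely generated cohomology are in `D^f(R)`. -/
theorem finiteCohomology_of_degree_zero (X : DerivedCategory (ModuleCat.{u} R))
    (h₀ : Module.Finite R (cohomology R X 0)) (h : ∀ i : ℤ, i ≠ 0 → IsZero (cohomology R X i)) :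
    finiteCohomology R X := by
  refine Module.Finite.of_surjective (DirectSum.lof R ℤ (fun i => cohomology R X i) 0) ?_
  intro x
  refine ⟨x 0, ?_⟩
  ext i
  by_cases hi : i = 0
  · subst hi
    simp [DirectSum.lof_apply]
  · have := ModuleCat.subsingleton_of_isZero (h i hi)
    exact Subsingleton.elim _ _

instance : (finiteCohomology R).ContainsZero where
  exists_zero := ⟨0, isZero_zero _, by
    have h (i : ℤ) : IsZero (cohomology R 0 i) :=
      Functor.map_isZero _ (isZero_zero _)
    refine finiteCohomology_of_degree_zero R 0 ?_ (fun i _ => h i)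
    have := ModuleCat.subsingleton_of_isZero (h 0)
    infer_instance⟩

instance [IsNoetherianRing R] : (finiteCohomology R).IsTriangulated where
  toIsTriangulatedClosed₂ := .mk' (by
    intro T hT h₁ h₃
    have : Module.Finite R (⨁ i : ℤ, cohomology R T.obj₁ i) := h₁
    have : Module.Finite R (⨁ i : ℤ, cohomology R T.obj₃ i) := h₃
    let f : ∀ i, cohomology R T.obj₁ i →ₗ[R] cohomology R T.obj₂ i := fun i =>
      ((DerivedCategory.homologyFunctor (ModuleCat.{u} R) i).map T.mor₁).hom
    let g : ∀ i, cohomology R T.obj₂ i →ₗ[R] cohomology R T.obj₃ i := fun i =>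
      ((DerivedCategory.homologyFunctor (ModuleCat.{u} R) i).map T.mor₂).hom
    have hfg (i : ℤ) : LinearMap.range (f i) = LinearMap.ker (g i) :=
      (DerivedCategory.HomologySequence.exact₂ T hT i).moduleCat_range_eq_ker
    let F : (⨁ i : ℤ, cohomology R T.obj₁ i) →ₗ[R] (⨁ i : ℤ, cohomology R T.obj₂ i) :=
      DFinsupp.mapRange.linearMap f
    let G : (⨁ i : ℤ, cohomology R T.obj₂ i) →ₗ[R] (⨁ i : ℤ, cohomology R T.obj₃ i) :=
      DFinsupp.mapRange.linearMap g
    have hFG : LinearMap.range F = LinearMap.ker G := by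
      ext x
      constructor
      · rintro ⟨y, rfl⟩
        rw [LinearMap.mem_ker]
        refine DFinsupp.ext (fun i => ?_)
        have : f i (y i) ∈ LinearMap.ker (g i) := hfg i ▸ LinearMap.mem_range_self _ _
        exact this
      · intro hx
        have hx' (i : ℤ) : ∃ y, f i y = x i := by
          have : x i ∈ LinearMap.ker (g i) := DFunLike.congr_fun hx i
          rwa [← hfg i] at this
        choose y hy using hx'
        classical
        let z : Π₀ i : ℤ, cohomology R T.obj₁ i := DFinsupp.mk x.support (fun i => y i)
        refine ⟨z, DFinsupp.ext (fun i => ?_)⟩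
        change f i (z i) = x i
        dsimp only [z]
        rw [DFinsupp.mk_apply]
        split_ifs with hi
        · exact hy i
        · rw [map_zero, DFinsupp.notMem_support_iff.1 hi]
    have : IsNoetherian R (⨁ i : ℤ, cohomology R T.obj₂ i) :=
      isNoetherian_of_range_eq_ker F G hFG
    exact (inferInstance : Module.Finite R (⨁ i : ℤ, cohomology R T.obj₂ i)))

end FiniteTotalCohomology

section Perfect

variable (R : Type u) [CommRing R]

/-- A cochain complex of `R`-modules that is bounded and consists of finitely generated
projective modules. -/
structure IsBoundedFiniteProjective (K : CochainComplex (ModuleCat.{u} R) ℤ) : Prop where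
  finite (i : ℤ) : Module.Finite R (K.X i)
  projective (i : ℤ) : Module.Projective R (K.X i)
  bounded : ∃ a b : ℤ, ∀ i : ℤ, i < a ∨ b < i → IsZero (K.X i)

variable {R} in
theorem IsBoundedFiniteProjective.shift {K : CochainComplex (ModuleCat.{u} R) ℤ}
    (hK : IsBoundedFiniteProjective R K) (n : ℤ) : IsBoundedFiniteProjective R (K⟦n⟧) where
  finite i := hK.finite (i + n)
  projective i := hK.projective (i + n)
  bounded := by
    obtain ⟨a, b, h⟩ := hK.bounded
    exact ⟨a - n, b - n, fun i hi => h (i + n) (by lia)⟩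

variable {R} in
theorem IsBoundedFiniteProjective.mappingCone {K L : CochainComplex (ModuleCat.{u} R) ℤ}
    (hK : IsBoundedFiniteProjective R K) (hL : IsBoundedFiniteProjective R L) (f : K ⟶ L) :
    IsBoundedFiniteProjective R (CochainComplex.mappingCone f) := by
  have e (i : ℤ) : (K.X (i + 1) × L.X i) ≃ₗ[R] (CochainComplex.mappingCone f).X i :=
    (HomologicalComplex.homotopyCofiber.XIsoBiprod f i (i + 1) rfl ≪≫
      ModuleCat.biprodIsoProd _ _).symm.toLinearEquiv
  refine ⟨fun i => ?_, fun i => ?_, ?_⟩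
  · have := hK.finite (i + 1)
    have := hL.finite i
    exact Module.Finite.equiv (e i)
  · have := hK.projective (i + 1)
    have := hL.projective i
    exact Module.Projective.of_equiv (e i)
  · obtain ⟨a, b, h⟩ := hK.bounded
    obtain ⟨c, d, h'⟩ := hL.bounded
    refine ⟨min (a - 1) c, max (b - 1) d, fun i hi => ?_⟩
    rw [CochainComplex.mappingCone.isZero_X_iff]
    exact ⟨h _ (by lia), h' _ (by lia)⟩

variable {R} in
theorem IsBoundedFiniteProjective.isKProjective {K : CochainComplex (ModuleCat.{u} R) ℤ}
    (hK : IsBoundedFiniteProjective R K) : K.IsKProjective := by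
  obtain ⟨a, b, h⟩ := hK.bounded
  have : K.IsStrictlyLE b := by
    rw [CochainComplex.isStrictlyLE_iff]
    exact fun i hi => h i (Or.inr hi)
  have (i : ℤ) : Projective (K.X i) :=
    (IsProjective.iff_projective (K.X i)).1 (hK.projective i)
  exact CochainComplex.isKProjective_of_projective K b

variable [HasDerivedCategory.{w} (ModuleCat.{u} R)]

/-- The perfect objects of `D(R)`: those isomorphic in `D(R)` to a bounded complex of finitely
generated projective `R`-modules. -/
def perfect : ObjectProperty (DerivedCategory (ModuleCat.{u} R)) :=
  fun X => ∃ K : CochainComplex (ModuleCat.{u} R) ℤ,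
    IsBoundedFiniteProjective R K ∧ Nonempty (X ≅ DerivedCategory.Q.obj K)

instance : (perfect R).IsClosedUnderIsomorphisms where
  of_iso := by
    rintro X Y e ⟨K, hK, ⟨e'⟩⟩
    exact ⟨K, hK, ⟨e.symm ≪≫ e'⟩⟩

instance : (perfect R).ContainsZero where
  exists_zero := by
    have h (i : ℤ) : IsZero ((0 : CochainComplex (ModuleCat.{u} R) ℤ).X i) :=
      Functor.map_isZero (HomologicalComplex.eval _ _ i) (isZero_zero _)
    have h' (i : ℤ) := ModuleCat.subsingleton_of_isZero (h i)
    exact ⟨DerivedCategory.Q.obj 0, Functor.map_isZero _ (isZero_zero _), 0,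
      ⟨fun i => inferInstance, fun i => inferInstance, 0, 0, fun i _ => h i⟩, ⟨Iso.refl _⟩⟩

instance : (perfect R).IsStableUnderShift ℤ where
  isStableUnderShiftBy n :=
    { le_shift := by
        rintro X ⟨K, hK, ⟨e⟩⟩
        exact ⟨K⟦n⟧, hK.shift n, ⟨(shiftFunctor _ n).mapIso e ≪≫
          (DerivedCategory.Q.commShiftIso n).symm.app K⟩⟩ }

instance : (perfect R).IsTriangulatedClosed₃ := .mk' (by
  rintro T hT ⟨K, hK, ⟨e₁⟩⟩ ⟨L, hL, ⟨e₂⟩⟩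
  have := hK.isKProjective
  obtain ⟨φ, hφ⟩ := (CochainComplex.IsKProjective.Qh_map_bijective K
    ((HomotopyCategory.quotient _ _).obj L)).surjective
      ((DerivedCategory.quotientCompQhIso _).hom.app K ≫ (e₁.inv ≫ T.mor₁ ≫ e₂.hom) ≫
        (DerivedCategory.quotientCompQhIso _).inv.app L)
  obtain ⟨f, rfl⟩ := (HomotopyCategory.quotient _ _).map_surjective φ
  have hf : DerivedCategory.Q.map f = e₁.inv ≫ T.mor₁ ≫ e₂.hom := by
    have := DerivedCategory.quotientCompQhIso_hom_naturality f
    rw [hφ] at this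
    simpa using this.symm
  obtain ⟨e, _⟩ := exists_iso_of_arrow_iso _ _ hT
    (DerivedCategory.mappingCone_triangle_distinguished f)
    (Arrow.isoMk e₁ e₂ ((by rw [hf]; simp :
      e₁.hom ≫ DerivedCategory.Q.map f = T.mor₁ ≫ e₂.hom)))
  exact ⟨CochainComplex.mappingCone f, hK.mappingCone hL f, ⟨Triangle.π₃.mapIso e⟩⟩)

instance : (perfect R).IsTriangulated where
  toIsTriangulatedClosed₂ := .of_isTriangulatedClosed₃

end Perfect

section Quotient

variable (R : Type u) [CommRing R] [IsNoetherianRing R] [HasDerivedCategory.{w} (ModuleCat.{u} R)]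

/-- The triangulated category `D^f(R)`, a full subcategory of the derived category `D(R)`. -/
abbrev Df := (finiteCohomology R).FullSubcategory

/-- The perfect complexes, as a full triangulated subcategory of `D^f(R)`. -/
abbrev perf : ObjectProperty (Df R) :=
  (perfect R).inverseImage (finiteCohomology R).ι

/-- The singularity category `D_sg(R) = D^f(R) / perf(R)`: the Verdier quotient, i.e. the
localization of `D^f(R)` at the morphisms whose cone is perfect, with its triangulated structure. -/
abbrev Dsg := (perf R).trW.Localization

/-- The quotient functor `D^f(R) ⥤ D_sg(R)`. -/
noncomputable abbrev quotientFunctor : Df R ⥤ Dsg R := (perf R).trW.Q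

end Quotient

/-- The smallest thick subcategory (a full subcategory closed under isomorphisms, shifts, cones
and direct summands) containing the object `X` of a triangulated category. -/
abbrev thick {T : Type*} [Category* T] [HasZeroObject T] [HasShift T ℤ] [Preadditive T]
    [∀ n : ℤ, (shiftFunctor T n).Additive] [Pretriangulated T] (X : T) : ObjectProperty T :=
  (ObjectProperty.singleton X).triangEnvelope

section Local

variable (R : Type u) [CommRing R] [IsLocalRing R]

/-- The residue field, as an object of `D(R)` concentrated in degree `0`. -/
noncomputable abbrev residueFieldComplex [HasDerivedCategory.{w} (ModuleCat.{u} R)] :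
    DerivedCategory (ModuleCat.{u} R) :=
  (DerivedCategory.singleFunctor (ModuleCat.{u} R) 0).obj
    (ModuleCat.of R (IsLocalRing.ResidueField R))

theorem finiteCohomology_residueFieldComplex [HasDerivedCategory.{w} (ModuleCat.{u} R)] :
    finiteCohomology R (residueFieldComplex R) := by
  let k := ModuleCat.of R (IsLocalRing.ResidueField R)
  let K := (HomologicalComplex.single (ModuleCat.{u} R) (ComplexShape.up ℤ) 0).obj k
  have e (i : ℤ) : cohomology R (residueFieldComplex R) i ≅ K.homology i :=
    (DerivedCategory.homologyFunctorFactors (ModuleCat.{u} R) i).app K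
  refine finiteCohomology_of_degree_zero R _ ?_ (fun i hi => ?_)
  · have : Module.Finite R k :=
      Module.Finite.of_surjective (Algebra.linearMap R (IsLocalRing.ResidueField R))
        IsLocalRing.residue_surjective
    exact Module.Finite.equiv
      (e 0 ≪≫ HomologicalComplex.singleObjHomologySelfIso _ 0 k).symm.toLinearEquiv
  · exact (HomologicalComplex.isZero_single_obj_homology _ 0 k i hi).of_iso (e i)

/-- The residue field `k` as an object of `D_sg(R)`. -/
noncomputable def residueField [IsNoetherianRing R] [HasDerivedCategory.{w} (ModuleCat.{u} R)] :
    Dsg R :=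
  (quotientFunctor R).obj ⟨residueFieldComplex R, finiteCohomology_residueFieldComplex R⟩

/-- A local ring has an isolated singularity if its localization at every nonmaximal prime
is a regular local ring (`R` itself is allowed to be regular). -/
def HasIsolatedSingularity : Prop :=
  ∀ (p : Ideal R) [p.IsPrime], p ≠ IsLocalRing.maximalIdeal R →
    IsRegularLocalRing (Localization.AtPrime p)

end Local

end SingularityCategory

/-!
Both implications rest on one device. For a multiplicative set `S` of `R`, the objects of an
`R`-linear triangulated category annihilated by some element of `S` form a thick subcategory,
`smulTorsion S`. For `S` the complement of a prime `p`, membership of a finitely generated module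
`M` in this subcategory of `D_sg(R)` is governed by the projective dimension of `M_p`: if that is
finite, then some `r ∉ p` kills `M` in `D_sg(R)` (`singularSmulTorsion_fgSingle`); conversely, if
`r ∉ p` kills `M` there, then multiplication by `r` on `M` factors through a perfect complex, so `r`
kills `Extⁿ(M, -)` for large `n`, and the projective dimension of `M_p` is finite
(`exists_forall_smul_ext_eq_zero`, `hasProjectiveDimensionLE_localizedModule_of_smul_ext_eq_zero`).

Suppose `R` has an isolated singularity. By the Auslander–Buchsbaum–Serre theorem every finitely
generated module over `R_p`, `p ≠ 𝔪`, has finite projective dimension, so by dévissage along the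
standard t-structure every object of `D_sg(R)` is killed by an element outside `p`. Its annihilator
is therefore contained in no prime other than `𝔪`, i.e. the elements of `𝔪` act nilpotently on it.
Coning off powers of generators of `𝔪` exhibits each object `X` of `D_sg(R)` as a direct summand of
the image of a complex whose cohomology modules are finitely generated and `𝔪`-power torsion
(`exists_retract_smulTorsion`); such a complex is an iterated extension of shifts of `k`, so `X`
lies in the thick subcategory generated by `k`.

Suppose conversely that `k` generates `D_sg(R)`, and let `p ≠ 𝔪`. An element of `𝔪` outside `p`
kills `k`, so every object of `D_sg(R)` is killed by an element outside `p`. For the module `R/p`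
this says that the residue field of `R_p` has finite projective dimension, and `R_p` is regular by
the homological half of the Auslander–Buchsbaum–Serre theorem
(`isRegularLocalRing_of_hasProjectiveDimensionLE`).

Both halves of the Auslander–Buchsbaum–Serre theorem are proved by induction on the dimension,
reducing modulo an element of `𝔪 ∖ 𝔪²` and comparing projective dimensions over `S` and `S/x`
(`hasProjectiveDimensionLE_quotSMulTop_iff`).
-/

namespace SingularityCategory

/-! ### Local algebra: reduction modulo a regular element -/

section LocalAlgebra

open IsLocalRing

variable {S : Type u} [CommRing S]

theorem isLocalRing_quotient_span_singleton [IsLocalRing S] {x : S} (hx : x ∈ maximalIdeal S) :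
    IsLocalRing (S ⧸ Ideal.span {x}) :=
  have : Nontrivial (S ⧸ Ideal.span {x}) := Ideal.Quotient.nontrivial_iff.2 fun h =>
    (Ideal.ne_top_iff_exists_maximal.2 ⟨maximalIdeal S, maximalIdeal.isMaximal S,
      (Ideal.span_singleton_le_iff_mem _).2 hx⟩) h
  .of_surjective' (Ideal.Quotient.mk _) Ideal.Quotient.mk_surjective

theorem projective_iff_free_of_isLocalRing [IsLocalRing S] (M : Type*) [AddCommGroup M] [Module S M]
    [Module.Finite S M] : Module.Projective S M ↔ Module.Free S M :=
  ⟨fun _ => Module.free_of_flat_of_isLocalRing, fun _ => inferInstance⟩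

theorem hasProjectiveDimensionLE_zero_iff (M : ModuleCat.{u} S) :
    HasProjectiveDimensionLE M 0 ↔ Module.Projective S M := by
  rw [← projective_iff_hasProjectiveDimensionLE_zero, IsProjective.iff_projective]

theorem isSMulRegular_of_free {F : Type*} [AddCommGroup F] [Module S F] [Module.Free S F] {x : S}
    (hx : IsSMulRegular S x) : IsSMulRegular F x :=
  ((Module.Free.chooseBasis S F).repr.isSMulRegular_congr x).2 fun a b h => by
    ext i
    exact hx (DFunLike.congr_fun h i)

/-- Change of rings for projective dimension: if `x` is regular on `S` and on `M`, then
reducing modulo `x` turns a free presentation of `M` into one of `M/xM`, and freeness can be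
tested modulo `x`. -/
theorem hasProjectiveDimensionLE_quotSMulTop_iff [IsLocalRing S] [IsNoetherianRing S] {x : S}
    (hx : x ∈ maximalIdeal S) (hreg : IsSMulRegular S x) (n : ℕ) (M : Type u) [AddCommGroup M]
    [Module S M] [Module.Finite S M] (hM : IsSMulRegular M x) :
    HasProjectiveDimensionLE (ModuleCat.of (S ⧸ Ideal.span {x}) (QuotSMulTop x M)) n ↔
      HasProjectiveDimensionLE (ModuleCat.of S M) n := by
  have := isLocalRing_quotient_span_singleton hx
  induction n generalizing M with
  | zero =>
    have : Module.Finite (S ⧸ Ideal.span {x}) (QuotSMulTop x M) :=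
      Module.Finite.of_restrictScalars_finite S _ _
    have : Module.FinitePresentation S M := Module.finitePresentation_of_finite S M
    rw [hasProjectiveDimensionLE_zero_iff, hasProjectiveDimensionLE_zero_iff]
    change Module.Projective _ (QuotSMulTop x M) ↔ Module.Projective S M
    rw [projective_iff_free_of_isLocalRing, projective_iff_free_of_isLocalRing]
    exact Module.free_quotSMulTop_iff_free S M
      (by rwa [IsLocalRing.jacobson_eq_maximalIdeal ⊥ bot_ne_top]) hM
  | succ n ih =>
    obtain ⟨F, _, _, _, _, f, hf⟩ := Module.exists_finite_presentation S M
    have hF : IsSMulRegular F x := isSMulRegular_of_free hreg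
    have hK : IsSMulRegular (LinearMap.ker f) x := hF.submodule _ x
    have hE := LinearMap.shortExact_shortComplexKer hf
    let q := (Ideal.Quotient.mk_surjective (I := Ideal.span {x}))
    let i' := (QuotSMulTop.map x (LinearMap.ker f).subtype).extendScalarsOfSurjective q
    let f' := (QuotSMulTop.map x f).extendScalarsOfSurjective q
    have hfi : Function.Exact (LinearMap.ker f).subtype f := fun _ => by simp
    have hinj : Function.Injective i' := by
      have h₀ : Function.Exact (0 : PUnit.{1} →ₗ[S] LinearMap.ker f) (LinearMap.ker f).subtype :=
        (LinearMap.exact_zero_iff_injective _ _).2 (LinearMap.ker f).injective_subtype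
      have h := QuotSMulTop.map_first_exact_on_four_term_exact_of_isSMulRegular_last h₀ hfi hM
      rw [map_zero] at h
      exact (LinearMap.exact_zero_iff_injective _ _).1 h
    have hexact : Function.Exact i' f' := QuotSMulTop.map_exact x hfi hf
    have hsurj : Function.Surjective f' := QuotSMulTop.map_surjective x hf
    have hE' := ModuleCat.shortComplex_shortExact
      (ModuleCat.shortComplexOfCompEqZero i' f' hexact.linearMap_comp_eq_zero) hexact hinj hsurj
    rw [HasProjectiveDimensionLE, HasProjectiveDimensionLE,
      hE.hasProjectiveDimensionLT_X₃_iff n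
        (ModuleCat.projective_of_free (Module.Free.chooseBasis S F)),
      hE'.hasProjectiveDimensionLT_X₃_iff n
        (ModuleCat.projective_of_free
          (Module.Free.chooseBasis (S ⧸ Ideal.span {x}) (QuotSMulTop x F)))]
    exact ih (LinearMap.ker f) hK

section EmbeddingDimension

variable [IsLocalRing S]

theorem comap_maximalIdeal_quotient_span_singleton {x : S} [IsLocalRing (S ⧸ Ideal.span {x})] :
    (maximalIdeal (S ⧸ Ideal.span {x})).comap (Ideal.Quotient.mk (Ideal.span {x})) =
      maximalIdeal S := by
  have : IsLocalHom (Ideal.Quotient.mk (Ideal.span {x})) :=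
    .of_surjective _ Ideal.Quotient.mk_surjective
  exact ((local_hom_TFAE (Ideal.Quotient.mk (Ideal.span {x}))).out 0 4).1 this

theorem map_maximalIdeal_quotient_span_singleton {x : S} [IsLocalRing (S ⧸ Ideal.span {x})] :
    (maximalIdeal S).map (Ideal.Quotient.mk (Ideal.span {x})) =
      maximalIdeal (S ⧸ Ideal.span {x}) := by
  rw [← comap_maximalIdeal_quotient_span_singleton (x := x)]
  exact Ideal.map_comap_of_surjective _ Ideal.Quotient.mk_surjective _

variable [IsNoetherianRing S]

theorem spanFinrank_maximalIdeal_quotient_add_one_le {x : S} (hx : x ∈ maximalIdeal S)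
    (hx2 : x ∉ maximalIdeal S ^ 2) [IsLocalRing (S ⧸ Ideal.span {x})] :
    (maximalIdeal (S ⧸ Ideal.span {x})).spanFinrank + 1 ≤ (maximalIdeal S).spanFinrank := by
  classical
  obtain ⟨s, hs, hspan⟩ := Submodule.FG.exists_span_finset_card_eq_spanFinrank
    (maximalIdeal S).fg_of_isNoetherianRing
  have hsm : ∀ g ∈ s, g ∈ maximalIdeal S := fun g hg => hspan ▸ Submodule.subset_span hg
  obtain ⟨a, -, ha⟩ := Submodule.mem_span_finset.1
    (hspan.symm ▸ hx : x ∈ Submodule.span S (s : Set S))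
  -- one coefficient is a unit, as `x ∉ 𝔪²`; the corresponding generator is redundant modulo `x`
  obtain ⟨g, hg, hag⟩ : ∃ g ∈ s, a g ∉ maximalIdeal S := by
    by_contra! h
    refine hx2 (ha ▸ Ideal.sum_mem _ fun g hg => ?_)
    rw [pow_two]
    exact Ideal.mul_mem_mul (h g hg) (hsm g hg)
  have hu : IsUnit (a g) := by simpa using hag
  rw [← hs, ← Finset.card_erase_add_one hg]
  gcongr
  let q := Ideal.Quotient.mk (Ideal.span {x})
  have key : maximalIdeal (S ⧸ Ideal.span {x}) =
      Submodule.span _ (((s.erase g).image q : Finset _) : Set _) := by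
    rw [← map_maximalIdeal_quotient_span_singleton, ← hspan]
    change Ideal.map q (Ideal.span _) = Ideal.span _
    rw [Ideal.map_span]
    refine le_antisymm (Ideal.span_le.2 ?_) (Ideal.span_mono ?_)
    · rintro _ ⟨y, hy, rfl⟩
      by_cases hyg : y = g
      · subst hyg
        have h0 : q (a y) * q y + ∑ z ∈ s.erase y, q (a z) * q z = 0 := by
          rw [Finset.add_sum_erase s (fun z => q (a z) * q z) hg, ← map_zero q]
          simp_rw [← map_mul, ← map_sum]
          rw [map_zero, Ideal.Quotient.eq_zero_iff_mem, show ∑ z ∈ s, a z * z = x from ha]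
          exact Ideal.mem_span_singleton_self x
        refine (Ideal.unit_mul_mem_iff_mem _ (hu.map q)).1 ?_
        rw [eq_neg_of_add_eq_zero_left h0]
        refine neg_mem (Ideal.sum_mem _ fun z hz => Ideal.mul_mem_left _ _ (Ideal.subset_span ?_))
        exact Finset.mem_coe.2 (Finset.mem_image_of_mem q hz)
      · exact Ideal.subset_span (Finset.mem_coe.2
          (Finset.mem_image_of_mem q (Finset.mem_erase.2 ⟨hyg, hy⟩)))
    · rw [Finset.coe_image]
      exact Set.image_mono (Finset.coe_subset.2 (Finset.erase_subset g s))
  rw [key]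
  refine (Submodule.spanFinrank_span_le_ncard_of_finite (Finset.finite_toSet _)).trans ?_
  rw [Set.ncard_coe_finset]
  exact Finset.card_image_le

theorem spanFinrank_maximalIdeal_le_quotient_add_one {x : S}
    [IsLocalRing (S ⧸ Ideal.span {x})] :
    (maximalIdeal S).spanFinrank ≤ (maximalIdeal (S ⧸ Ideal.span {x})).spanFinrank + 1 := by
  classical
  let q := Ideal.Quotient.mk (Ideal.span {x})
  obtain ⟨s, hs, hspan⟩ := Submodule.FG.exists_span_finset_card_eq_spanFinrank
    (maximalIdeal (S ⧸ Ideal.span {x})).fg_of_isNoetherianRing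
  obtain ⟨σ, hσ⟩ := (Ideal.Quotient.mk_surjective (I := Ideal.span {x})).hasRightInverse
  have key : maximalIdeal S = Submodule.span S ((insert x (s.image σ) : Finset S) : Set S) := by
    change _ = Ideal.span _
    have h1 : maximalIdeal S = (maximalIdeal (S ⧸ Ideal.span {x})).comap q :=
      comap_maximalIdeal_quotient_span_singleton.symm
    have h2 : (Ideal.span ((s.image σ : Finset S) : Set S)).map q = maximalIdeal _ := by
      rw [Ideal.map_span, Finset.coe_image, Set.image_image]
      simp only [q, hσ _, Set.image_id']
      exact hspan
    rw [h1, ← h2, Ideal.comap_map_of_surjective' _ Ideal.Quotient.mk_surjective, Ideal.mk_ker,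
      Finset.coe_insert, Ideal.span_insert, sup_comm]
  rw [← hs, key]
  refine (Submodule.spanFinrank_span_le_ncard_of_finite (Finset.finite_toSet _)).trans ?_
  rw [Set.ncard_coe_finset]
  exact (Finset.card_insert_le _ _).trans (Nat.add_le_add_right Finset.card_image_le 1)

/-- Prime avoidance: outside a field, there are elements of `𝔪 ∖ 𝔪²` that avoid a given finite
family of nonmaximal primes. -/
theorem exists_mem_maximalIdeal_notMem_sq (h : maximalIdeal S ≠ ⊥) (T : Set (Ideal S))
    (hT : T.Finite) (hprime : ∀ q ∈ T, q.IsPrime) (hne : maximalIdeal S ∉ T) :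
    ∃ x ∈ maximalIdeal S, x ∉ maximalIdeal S ^ 2 ∧ ∀ q ∈ T, x ∉ q := by
  classical
  by_contra! hcon
  have hsub : (maximalIdeal S : Set S) ⊆
      ⋃ i ∈ ((insert (maximalIdeal S ^ 2) hT.toFinset : Finset (Ideal S)) : Set (Ideal S)),
        (id i : Ideal S) := by
    intro x hx
    rw [Set.mem_iUnion₂]
    by_cases hx2 : x ∈ maximalIdeal S ^ 2
    · exact ⟨_, by simp, hx2⟩
    · obtain ⟨q, hq, hxq⟩ := hcon x hx hx2
      exact ⟨q, by simp [hq], hxq⟩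
  obtain ⟨q, hq, hle⟩ := (Ideal.subset_union_prime (maximalIdeal S ^ 2) (maximalIdeal S ^ 2)
    (by
      intro i hi h1 _
      rw [Finset.mem_insert, Set.Finite.mem_toFinset] at hi
      exact hprime _ (hi.resolve_left h1))).1 hsub
  rw [Finset.mem_insert, Set.Finite.mem_toFinset] at hq
  rcases hq with rfl | hq
  · refine h (Submodule.eq_bot_of_le_smul_of_le_jacobson_bot (maximalIdeal S) _
      (maximalIdeal S).fg_of_isNoetherianRing ?_ (IsLocalRing.maximalIdeal_le_jacobson _))
    simpa [pow_two] using hle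
  · exact hne (((maximalIdeal.isMaximal S).eq_of_le (hprime q hq).ne_top hle).symm ▸ hq)

end EmbeddingDimension

end LocalAlgebra

/-! ### Regular local rings and projective dimension -/

section Regular

open IsLocalRing

variable {S : Type u} [CommRing S]

theorem isRegularLocalRing_quotient_span_singleton [IsRegularLocalRing S] {x : S}
    (hx : x ∈ maximalIdeal S) (hx2 : x ∉ maximalIdeal S ^ 2) :
    IsRegularLocalRing (S ⧸ Ideal.span {x}) := by
  have := isLocalRing_quotient_span_singleton hx
  refine .of_spanFinrank_maximalIdeal_le _ ?_
  have h1 := spanFinrank_maximalIdeal_quotient_add_one_le hx hx2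
  have h2 : ringKrullDim S ≤ ringKrullDim (S ⧸ Ideal.span {x}) + 1 := by
    have := ringKrullDim_le_ringKrullDim_quotient_add_card {x}
      (by simpa [IsLocalRing.ringJacobson_eq_maximalIdeal] using hx)
    rwa [Finset.coe_singleton, Finset.card_singleton, Nat.cast_one] at this
  rw [← (isRegularLocalRing_iff S).1 inferInstance] at h2
  have h3 := (Nat.cast_le (α := WithBot ℕ∞)).2 h1
  push_cast at h3
  have h4 := h3.trans h2
  exact (ENat.WithBot.add_le_add_natCast_right_iff (c := 1)).1 (by exact_mod_cast h4)

/-- A regular local ring is a domain and its finitely generated modules have finite projective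
dimension. The two are proved together: that `S` is a domain makes the element `x ∈ 𝔪 ∖ 𝔪²` regular
on first syzygies, whose reductions modulo `x` are modules over the regular ring `S/x`. -/
theorem isDomain_and_finite_projectiveDimension (n : ℕ) (S : Type u) [CommRing S]
    [IsRegularLocalRing S] (hn : (maximalIdeal S).spanFinrank = n) :
    IsDomain S ∧ ∀ (M : Type u) [AddCommGroup M] [Module S M] [Module.Finite S M],
      ∃ k, HasProjectiveDimensionLE (ModuleCat.of S M) k := by
  induction n generalizing S with
  | zero =>
    have hf : IsField S := IsLocalRing.isField_iff_maximalIdeal_eq.2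
      ((Submodule.spanFinrank_eq_zero_iff_eq_bot (maximalIdeal S).fg_of_isNoetherianRing).1 hn)
    refine ⟨hf.isDomain, fun M _ _ _ => ⟨0, (hasProjectiveDimensionLE_zero_iff _).2 ?_⟩⟩
    let := hf.toField
    change Module.Projective S M
    infer_instance
  | succ n ih =>
    have hdim : (maximalIdeal S).height = (n + 1 : ℕ) := by
      have := maximalIdeal_height_eq_ringKrullDim (R := S)
      rw [← (isRegularLocalRing_iff S).1 inferInstance, hn] at this
      exact_mod_cast this
    obtain ⟨x, hx, hx2, hxq⟩ := exists_mem_maximalIdeal_notMem_sq (S := S)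
      (by intro h; rw [h, Submodule.spanFinrank_bot] at hn; simp at hn)
      (minimalPrimes S) (minimalPrimes.finite_of_isNoetherianRing S)
      (fun q hq => hq.1.1) (fun h => by
        have := Ideal.height_eq_zero_iff.2 h
        rw [hdim] at this
        simp at this)
    have hreg' := isRegularLocalRing_quotient_span_singleton hx hx2
    have hn' : (maximalIdeal (S ⧸ Ideal.span {x})).spanFinrank = n := by
      have h1 := spanFinrank_maximalIdeal_quotient_add_one_le hx hx2
      have h2 := spanFinrank_maximalIdeal_le_quotient_add_one (x := x)
      lia
    obtain ⟨hdom, hfin⟩ := ih (S ⧸ Ideal.span {x}) hn'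
    have hdomS : IsDomain S := by
      have hprime : (Ideal.span {x}).IsPrime := (Ideal.Quotient.isDomain_iff_prime _).1 hdom
      obtain ⟨q, hq, hle⟩ := Ideal.exists_minimalPrimes_le (bot_le : ⊥ ≤ Ideal.span {x})
      have hqp : q.IsPrime := hq.1.1
      -- `q ⊆ (x)` and `x ∉ q` give `q = x q`, so `q = 0` by Nakayama's lemma
      have hq0 : q = ⊥ := by
        refine Submodule.eq_bot_of_le_smul_of_le_jacobson_bot (Ideal.span {x}) _
          q.fg_of_isNoetherianRing (fun y hy => ?_)
          (((Ideal.span_singleton_le_iff_mem _).2 hx).trans (maximalIdeal_le_jacobson _))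
        obtain ⟨a, rfl⟩ := Ideal.mem_span_singleton'.1 (hle hy)
        rw [smul_eq_mul, mul_comm a x]
        exact Ideal.mul_mem_mul (Ideal.mem_span_singleton_self x)
          ((hqp.mem_or_mem hy).resolve_right (hxq q hq))
      exact (IsDomain.of_bot_isPrime S (hbp := hq0 ▸ hqp))
    refine ⟨hdomS, fun M _ _ _ => ?_⟩
    have hx0 : x ≠ 0 := fun h => hx2 (h ▸ zero_mem _)
    have hreg : IsSMulRegular S x := (IsRegular.of_ne_zero hx0).left.isSMulRegular
    obtain ⟨F, _, _, _, _, f, hf⟩ := Module.exists_finite_presentation S M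
    have hK : IsSMulRegular (LinearMap.ker f) x := (isSMulRegular_of_free hreg).submodule _ x
    have : Module.Finite (S ⧸ Ideal.span {x}) (QuotSMulTop x (LinearMap.ker f)) :=
      Module.Finite.of_restrictScalars_finite S _ _
    obtain ⟨k, hk⟩ := hfin (QuotSMulTop x (LinearMap.ker f))
    refine ⟨k + 1, ((LinearMap.shortExact_shortComplexKer hf).hasProjectiveDimensionLT_X₃_iff k
      (ModuleCat.projective_of_free (Module.Free.chooseBasis S F))).2 ?_⟩
    exact (hasProjectiveDimensionLE_quotSMulTop_iff hx hreg k _ hK).1 hk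

/-- One half of the Auslander–Buchsbaum–Serre theorem. -/
theorem exists_hasProjectiveDimensionLE_of_isRegularLocalRing [IsRegularLocalRing S] (M : Type u)
    [AddCommGroup M] [Module S M] [Module.Finite S M] :
    ∃ k, HasProjectiveDimensionLE (ModuleCat.of S M) k :=
  (isDomain_and_finite_projectiveDimension _ S rfl).2 M

/-- A local ring whose maximal ideal is annihilated by a nonzero element `s` has no nonfree
finitely generated module of finite projective dimension: multiplication by `s` detects whether an
element of a free module lies in `𝔪` times it, so an inclusion of free modules stays injective
modulo `𝔪`. -/
theorem free_of_hasProjectiveDimensionLE_of_socle [IsLocalRing S] [IsNoetherianRing S] {s : S}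
    (hs : s ≠ 0) (hms : ∀ a ∈ maximalIdeal S, a * s = 0) (n : ℕ) (M : Type u) [AddCommGroup M]
    [Module S M] [Module.Finite S M] (hM : HasProjectiveDimensionLE (ModuleCat.of S M) n) :
    Module.Free S M := by
  induction n generalizing M with
  | zero =>
    exact (projective_iff_free_of_isLocalRing M).1 ((hasProjectiveDimensionLE_zero_iff _).1 hM)
  | succ n ih =>
    obtain ⟨F, _, _, _, _, f, hf⟩ := Module.exists_finite_presentation S M
    have hK : Module.Free S (LinearMap.ker f) := ih _
      (((LinearMap.shortExact_shortComplexKer hf).hasProjectiveDimensionLT_X₃_iff n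
        (ModuleCat.projective_of_free (Module.Free.chooseBasis S F))).1 hM)
    refine Module.free_of_lTensor_residueField_injective (LinearMap.ker f).subtype f hf
      (fun _ => by simp) ((injective_iff_map_eq_zero _).2 fun t ht => ?_)
    obtain ⟨a, rfl⟩ := TensorProduct.mk_surjective S (LinearMap.ker f) (ResidueField S)
      residue_surjective t
    have hker (N : Type u) [AddCommGroup N] [Module S N] (y : N) :
        (1 : ResidueField S) ⊗ₜ[S] y = 0 ↔ y ∈ maximalIdeal S • (⊤ : Submodule S N) := by
      rw [← LinearMap.ker_tensorProductMk]
      rfl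
    have hsF : s • (a : F) = 0 := by
      have h := (hker F a).1 ht
      refine Submodule.smul_induction_on h (fun r hr y _ => ?_) (fun y z hy hz => ?_)
      · rw [smul_smul, mul_comm, hms r hr, zero_smul]
      · rw [smul_add, hy, hz, add_zero]
    have hsK : s • a = 0 := Subtype.ext hsF
    refine (hker _ a).2 ?_
    let b := Module.Free.chooseBasis S (LinearMap.ker f)
    rw [← b.linearCombination_repr a, Finsupp.linearCombination_apply]
    refine Submodule.sum_mem _ fun i _ => Submodule.smul_mem_smul ?_ trivial
    by_contra hi
    have hi' : IsUnit (b.repr a i) := by simpa using hi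
    have : s * b.repr a i = 0 := by
      have := DFunLike.congr_fun (congrArg b.repr hsK) i
      simpa using this
    exact hs ((hi'.mul_left_eq_zero).1 this)

/-- For `x ∈ 𝔪 ∖ 𝔪²`, the residue field of `S/x` is a direct summand of `𝔪/x𝔪`, spanned by the
class of `x`. -/
theorem nonempty_retract_residueField_quotSMulTop [IsLocalRing S] [IsNoetherianRing S] {x : S}
    (hx : x ∈ maximalIdeal S) (hx2 : x ∉ maximalIdeal S ^ 2) [IsLocalRing (S ⧸ Ideal.span {x})] :
    Nonempty (Retract
      (ModuleCat.of (S ⧸ Ideal.span {x})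
        ((S ⧸ Ideal.span {x}) ⧸ maximalIdeal (S ⧸ Ideal.span {x})))
      (ModuleCat.of (S ⧸ Ideal.span {x}) (QuotSMulTop x (maximalIdeal S)))) := by
  let S' := S ⧸ Ideal.span {x}
  let κ := S' ⧸ maximalIdeal S'
  let Q := QuotSMulTop x (maximalIdeal S)
  let x' : Q := Submodule.Quotient.mk ⟨x, hx⟩
  let i : κ →ₗ[S'] Q := Submodule.liftQ _ (LinearMap.toSpanSingleton S' Q x') (by
    intro a' ha'
    obtain ⟨a, rfl⟩ := Ideal.Quotient.mk_surjective a'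
    have ha : a ∈ maximalIdeal S := by
      rw [← comap_maximalIdeal_quotient_span_singleton (x := x)]
      exact ha'
    change (Submodule.Quotient.mk (a • ⟨x, hx⟩) : Q) = 0
    rw [Submodule.Quotient.mk_eq_zero]
    exact (Submodule.mem_smul_pointwise_iff_exists _ _ _).2
      ⟨⟨a, ha⟩, trivial, Subtype.ext (mul_comm x a)⟩)
  have hcot : (maximalIdeal S).toCotangent ⟨x, hx⟩ ≠ 0 := by
    rwa [Ne, Ideal.toCotangent_eq_zero]
  obtain ⟨φ, hφ⟩ : ∃ φ : Module.Dual (ResidueField S) (CotangentSpace S),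
      φ ((maximalIdeal S).toCotangent ⟨x, hx⟩) ≠ 0 := by
    by_contra! h
    exact hcot ((Module.forall_dual_apply_eq_zero_iff (ResidueField S) _).1 h)
  let ψ := (φ ((maximalIdeal S).toCotangent ⟨x, hx⟩))⁻¹ • φ
  have hψ : ψ ((maximalIdeal S).toCotangent ⟨x, hx⟩) = 1 := inv_mul_cancel₀ hφ
  let t : ResidueField S →ₗ[S] κ := Submodule.liftQ (maximalIdeal S) (Algebra.linearMap S κ) (by
    intro a ha
    change (Ideal.Quotient.mk (maximalIdeal S') (Ideal.Quotient.mk _ a)) = 0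
    rw [Ideal.Quotient.eq_zero_iff_mem]
    rw [← comap_maximalIdeal_quotient_span_singleton (x := x)] at ha
    exact ha)
  let g : maximalIdeal S →ₗ[S] κ :=
    t ∘ₗ (ψ.restrictScalars S) ∘ₗ (maximalIdeal S).toCotangent
  have hg : g ⟨x, hx⟩ = 1 := by
    change t (ψ _) = 1
    rw [hψ]
    exact map_one (algebraMap S κ)
  let r : Q →ₗ[S'] κ := (Submodule.liftQ _ g (by
    intro y hy
    obtain ⟨z, -, rfl⟩ := (Submodule.mem_smul_pointwise_iff_exists _ _ _).1 hy
    rw [LinearMap.mem_ker, map_smul, ← algebraMap_smul S' x,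
      show algebraMap S S' x = 0 from
        Ideal.Quotient.eq_zero_iff_mem.2 (Ideal.mem_span_singleton_self x), zero_smul])
    ).extendScalarsOfSurjective Ideal.Quotient.mk_surjective
  refine ⟨⟨ModuleCat.ofHom i, ModuleCat.ofHom r, ?_⟩⟩
  rw [← ModuleCat.ofHom_comp, ← ModuleCat.ofHom_id]
  congr 1
  refine Submodule.linearMap_qext _ (LinearMap.ext_ring ?_)
  change r ((1 : S') • x') = 1
  rw [one_smul]
  exact hg

/-- The homological half of the Auslander–Buchsbaum–Serre theorem, by induction on the dimension. -/
theorem isRegularLocalRing_of_ringKrullDim_lt (n : ℕ) (S : Type u) [CommRing S] [IsLocalRing S]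
    [IsNoetherianRing S] (hdim : ringKrullDim S < n) (k : ℕ)
    (hk : HasProjectiveDimensionLE (ModuleCat.of S (S ⧸ maximalIdeal S)) k) :
    IsRegularLocalRing S := by
  induction n generalizing S k with
  | zero => exact absurd hdim (not_lt.2 (by exact_mod_cast ringKrullDim_nonneg_of_nontrivial))
  | succ n ih =>
    by_cases hm : maximalIdeal S = ⊥
    · refine .of_spanFinrank_maximalIdeal_le _ ?_
      rw [hm, Submodule.spanFinrank_bot]
      exact_mod_cast ringKrullDim_nonneg_of_nontrivial
    obtain ⟨x, hx, hx2, hxa⟩ := exists_mem_maximalIdeal_notMem_sq hm (associatedPrimes S S)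
      (associatedPrimes.finite S S) (fun q hq => hq.1) (fun h => by
        -- if `𝔪` were associated to `S`, then `S/𝔪` would be free, so `𝔪 = 0`
        obtain ⟨-, s, hs⟩ := isAssociatedPrime_iff.1 h
        have hs' (a : S) : a ∈ maximalIdeal S ↔ a * s = 0 := by
          rw [hs, Submodule.mem_colon_singleton, smul_eq_mul, Submodule.mem_bot]
        have := free_of_hasProjectiveDimensionLE_of_socle (s := s) (by
          rintro rfl
          exact (maximalIdeal.isMaximal S).ne_top
            ((Ideal.eq_top_iff_one _).2 ((hs' 1).2 (mul_zero 1))))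
          (fun a ha => (hs' a).1 ha) k _ hk
        have h0 := Module.annihilator_eq_bot.2 (inferInstance : FaithfulSMul S (S ⧸ maximalIdeal S))
        rw [Ideal.annihilator_quotient] at h0
        exact hm h0)
    have hreg : IsSMulRegular S x := by
      by_contra h
      have hx' : x ∈ ⋃ p ∈ associatedPrimes S S, (p : Set S) := by
        rw [biUnion_associatedPrimes_eq_compl_regular]
        exact h
      obtain ⟨q, hq, hxq⟩ := Set.mem_iUnion₂.1 hx'
      exact hxa q hq hxq
    have := isLocalRing_quotient_span_singleton hx
    have hd := ringKrullDim_quotient_span_singleton_succ_eq_ringKrullDim hreg hx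
    have hreg' : IsRegularLocalRing (S ⧸ Ideal.span {x}) := by
      have hm1 : HasProjectiveDimensionLE (ModuleCat.of S (maximalIdeal S)) k := by
        have hk' : HasProjectiveDimensionLE (ModuleCat.of S (S ⧸ maximalIdeal S)) (k + 1) :=
          hasProjectiveDimensionLT_of_ge _ (k + 1) _ (by lia)
        have h1 := ((LinearMap.shortExact_shortComplexKer
          (maximalIdeal S).mkQ_surjective).hasProjectiveDimensionLT_X₃_iff k
          (ModuleCat.projective_of_free (Module.Free.chooseBasis S S))).1 hk'
        exact hasProjectiveDimensionLT_of_iso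
          (LinearEquiv.ofEq _ _ (maximalIdeal S).ker_mkQ).toModuleIso _
      have hq := (hasProjectiveDimensionLE_quotSMulTop_iff hx hreg k (maximalIdeal S)
        (hreg.submodule _ x)).2 hm1
      obtain ⟨ρ⟩ := nonempty_retract_residueField_quotSMulTop hx hx2
      refine ih (S ⧸ Ideal.span {x}) ?_ k (ρ.hasProjectiveDimensionLT _)
      rw [← hd] at hdim
      push_cast at hdim
      exact lt_of_add_lt_add_right hdim
    refine .of_spanFinrank_maximalIdeal_le _ ?_
    rw [← hd, ← (isRegularLocalRing_iff _).1 hreg']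
    exact_mod_cast spanFinrank_maximalIdeal_le_quotient_add_one (x := x)

/-- A noetherian local ring whose residue field has finite projective dimension is regular. -/
theorem isRegularLocalRing_of_hasProjectiveDimensionLE [IsLocalRing S] [IsNoetherianRing S] (k : ℕ)
    (hk : HasProjectiveDimensionLE (ModuleCat.of S (S ⧸ maximalIdeal S)) k) :
    IsRegularLocalRing S := by
  have h : (maximalIdeal S).height ≠ ⊤ := Ideal.height_ne_top_of_isPrime
  obtain ⟨d, hd⟩ := ENat.ne_top_iff_exists.1 h
  refine isRegularLocalRing_of_ringKrullDim_lt (d + 1) S ?_ k hk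
  rw [← maximalIdeal_height_eq_ringKrullDim, ← hd]
  exact_mod_cast Nat.lt_succ_self d

end Regular

/-! ### Projective dimension of localized modules -/

section LocalizedProjectiveDimension

open Abelian

variable {R : Type u} [CommRing R]

/-- A finitely presented module whose localization is projective becomes, up to multiplication
by an element of the multiplicative set, a direct summand of a finite free module. -/
theorem exists_smul_id_factors_of_projective_localizedModule [IsNoetherianRing R]
    (S : Submonoid R) (M : Type u) [AddCommGroup M] [Module R M] [Module.Finite R M]
    (hM : Module.Projective (Localization S) ((ModuleCat.of R M).localizedModule S)) :
    ∃ r ∈ S, ∃ (F : Type u) (_ : AddCommGroup F) (_ : Module R F) (_ : Module.Finite R F)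
      (_ : Module.Free R F) (i : M →ₗ[R] F) (p : F →ₗ[R] M), p ∘ₗ i = r • LinearMap.id := by
  obtain ⟨F, _, _, _, _, f, hf⟩ := Module.exists_finite_presentation R M
  have : Module.FinitePresentation R M := Module.finitePresentation_of_finite R M
  let lM := (ModuleCat.of R M).localizedModuleMkLinearMap S
  let lF := (ModuleCat.of R F).localizedModuleMkLinearMap S
  have : IsLocalizedModule S lM := ModuleCat.localizedModule_isLocalizedModule _ S
  have : IsLocalizedModule S lF := ModuleCat.localizedModule_isLocalizedModule _ S
  let f' := IsLocalizedModule.mapExtendScalars S lF lM (Localization S) f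
  have hf' : Function.Surjective f' := IsLocalizedModule.map_surjective S lF lM f hf
  obtain ⟨σ, hσ⟩ := Module.projective_lifting_property f' LinearMap.id hf'
  obtain ⟨i, s, hi⟩ := Module.FinitePresentation.exists_lift_of_isLocalizedModule S lF
    (σ.restrictScalars R ∘ₗ lM)
  obtain ⟨t, ht⟩ := Module.Finite.exists_smul_of_comp_eq_of_isLocalizedModule S lM
    (f ∘ₗ i) (s • LinearMap.id) (by
      ext m
      have h1 : lF (i m) = s • σ (lM m) := LinearMap.congr_fun hi m
      have h2 : f' (lF (i m)) = lM (f (i m)) := IsLocalizedModule.map_apply S lF lM f (i m)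
      have h3 : f' (σ (lM m)) = lM m := LinearMap.congr_fun hσ (lM m)
      change lM (f (i m)) = lM ((s : R) • m)
      calc lM (f (i m)) = f' (lF (i m)) := h2.symm
        _ = f' ((s : R) • σ (lM m)) := congrArg f' h1
        _ = (s : R) • f' (σ (lM m)) := (f'.restrictScalars R).map_smul (s : R) (σ (lM m))
        _ = (s : R) • lM m := congrArg ((s : R) • ·) h3
        _ = lM ((s : R) • m) := (lM.map_smul (s : R) m).symm)
  refine ⟨t * s, S.mul_mem t.2 s.2, F, inferInstance, inferInstance, inferInstance, inferInstance,
    (t : R) • i, f, ?_⟩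
  rw [LinearMap.comp_smul, mul_smul]
  exact ht

theorem projective_localizedModule_of_smul_id_factors (S : Submonoid R) {r : R} (hr : r ∈ S)
    {M F : ModuleCat.{u} R} [Projective F] (i : M ⟶ F) (p : F ⟶ M) (h : i ≫ p = r • 𝟙 M) :
    Projective (M.localizedModule S) := by
  let L := ModuleCat.localizedModuleFunctor.{u} S
  have : Projective (L.obj F) := inferInstance
  obtain ⟨u, hu⟩ := IsLocalization.map_units (Localization S) ⟨r, hr⟩
  have hL : L.map (r • 𝟙 M) = (u : Localization S) • 𝟙 (L.obj M) := by
    ext x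
    have h1 : (IsLocalizedModule.map S (M.localizedModuleMkLinearMap S)
        (M.localizedModuleMkLinearMap S) (r • LinearMap.id)) = r • LinearMap.id := by
      rw [map_smul, IsLocalizedModule.map_id]
    refine (LinearMap.congr_fun h1 x).trans ?_
    have h2 (y : M.localizedModule S) : r • y = (u : Localization S) • y := by
      rw [hu, algebraMap_smul]
    exact h2 x
  let ρ : Retract (L.obj M) (L.obj F) :=
    { i := L.map i
      r := L.map p ≫ (((u⁻¹ : (Localization S)ˣ) : Localization S) • 𝟙 (L.obj M))
      retract := by
        rw [← Category.assoc, ← L.map_comp, h, hL]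
        simp [smul_smul] }
  exact ρ.projective

/-- If an element of `S` annihilates `Extⁿ⁺¹(M, -)` then the localization of `M` at `S` has
projective dimension at most `n`. -/
theorem hasProjectiveDimensionLE_localizedModule_of_smul_ext_eq_zero [IsNoetherianRing R]
    (S : Submonoid R) {r : R} (hr : r ∈ S) (n : ℕ) (M : ModuleCat.{u} R) [Module.Finite R M]
    (h : ∀ (L : ModuleCat.{u} R) (e : Ext M L (n + 1)), r • e = 0) :
    HasProjectiveDimensionLE (M.localizedModule S) n := by
  induction n generalizing M with
  | zero =>
    obtain ⟨F, _, _, _, _, f, hf⟩ := Module.exists_finite_presentation R M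
    have hE := LinearMap.shortExact_shortComplexKer hf
    obtain ⟨φ, hφ⟩ := Ext.covariant_sequence_exact₃ M hE (Ext.mk₀ (r • 𝟙 M)) (zero_add 1) (by
      rw [Ext.mk₀_smul, Ext.smul_comp]
      exact h _ _)
    obtain ⟨i, rfl⟩ := (Ext.mk₀_bijective M _).2 φ
    rw [Ext.mk₀_comp_mk₀, (Ext.mk₀_bijective _ _).1.eq_iff] at hφ
    have : Projective (ModuleCat.of R F) :=
      ModuleCat.projective_of_free (Module.Free.chooseBasis R F)
    exact (projective_iff_hasProjectiveDimensionLE_zero _).1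
      (projective_localizedModule_of_smul_id_factors S hr i (ModuleCat.ofHom f) hφ)
  | succ n ih =>
    obtain ⟨F, _, _, _, _, f, hf⟩ := Module.exists_finite_presentation R M
    have hE := LinearMap.shortExact_shortComplexKer hf
    have hF : Projective (ModuleCat.of R F) :=
      ModuleCat.projective_of_free (Module.Free.chooseBasis R F)
    have hE' := hE.map_of_exact (ModuleCat.localizedModuleFunctor.{u} S)
    refine (hE'.hasProjectiveDimensionLT_X₃_iff n
      ((ModuleCat.localizedModuleFunctor.{u} S).projective_obj_of_projective hF)).2 ?_
    refine ih (ModuleCat.of R (LinearMap.ker f)) fun L e => ?_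
    obtain ⟨e', he'⟩ := Ext.contravariant_sequence_exact₁ hE L (r • e) (n₁ := n + 2) (by lia) (by
      rw [Ext.comp_smul]
      exact h _ _)
    rw [← he', Ext.eq_zero_of_projective (P := ModuleCat.of R F) e', Ext.comp_zero]

theorem nonempty_localizedModule_quotient_iso_residueField (p : Ideal R) [p.IsPrime] :
    Nonempty ((ModuleCat.of R (R ⧸ p)).localizedModule p.primeCompl ≅
      ModuleCat.of (Localization.AtPrime p)
        (Localization.AtPrime p ⧸ IsLocalRing.maximalIdeal (Localization.AtPrime p))) := by
  let S := Localization.AtPrime p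
  let f := (ModuleCat.of R (R ⧸ p)).localizedModuleMkLinearMap p.primeCompl
  have : IsLocalizedModule p.primeCompl f := ModuleCat.localizedModule_isLocalizedModule _ _
  let g := Submodule.toLocalizedQuotient' S p.primeCompl (Algebra.linearMap R S) p
  let e := (IsLocalizedModule.linearEquiv p.primeCompl f g).extendScalarsOfIsLocalization
    p.primeCompl S
  have h : Submodule.localized' S p.primeCompl (Algebra.linearMap R S) p =
      IsLocalRing.maximalIdeal S := by
    rw [Ideal.localized'_eq_map, Localization.AtPrime.map_eq_maximalIdeal]
  exact ⟨(e.trans (Submodule.quotEquivOfEq _ _ h)).toModuleIso⟩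

end LocalizedProjectiveDimension

/-! ### Objects annihilated by a multiplicative set -/

section SmulTorsion

variable {R : Type*} [CommRing R] {T : Type*} [Category* T] [Preadditive T] [Linear R T]

/-- The objects of an `R`-linear category that are annihilated by an element of the
multiplicative set `S`. -/
def smulTorsion (S : Submonoid R) : ObjectProperty T := fun X => ∃ r ∈ S, r • 𝟙 X = 0

theorem smul_hom_eq_zero_of_smul_id_eq_zero {X Y : T} {r : R} (h : r • 𝟙 Y = 0) (f : X ⟶ Y) :
    r • f = 0 := by
  rw [← Category.comp_id f, ← Linear.comp_smul, h, comp_zero]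

instance (S : Submonoid R) : (smulTorsion S : ObjectProperty T).IsStableUnderRetracts where
  of_retract := by
    rintro X Y ρ ⟨r, hr, h⟩
    refine ⟨r, hr, ?_⟩
    rw [← ρ.retract, ← Linear.smul_comp, smul_hom_eq_zero_of_smul_id_eq_zero h, zero_comp]

variable [HasZeroObject T] [HasShift T ℤ] [∀ n : ℤ, (shiftFunctor T n).Additive] [Pretriangulated T]
  [∀ n : ℤ, (shiftFunctor T n).Linear R]

instance (S : Submonoid R) : (smulTorsion S : ObjectProperty T).IsTriangulated where
  exists_zero := ⟨0, isZero_zero T, 1, S.one_mem, (isZero_zero T).eq_of_src _ _⟩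
  isStableUnderShiftBy n :=
    { le_shift := by
        rintro X ⟨r, hr, h⟩
        refine ⟨r, hr, ?_⟩
        rw [← (shiftFunctor T n).map_id, ← Functor.map_smul, h, Functor.map_zero] }
  toIsTriangulatedClosed₂ := .mk' (by
    rintro D hD ⟨r, hr, h⟩ ⟨s, hs, h'⟩
    refine ⟨r * s, S.mul_mem hr hs, ?_⟩
    obtain ⟨g, hg⟩ := Triangle.coyoneda_exact₂ D hD (s • 𝟙 D.obj₂) (by
      rw [Linear.smul_comp, Category.id_comp, smul_hom_eq_zero_of_smul_id_eq_zero h'])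
    rw [mul_smul, hg, ← Linear.smul_comp, smul_hom_eq_zero_of_smul_id_eq_zero h, zero_comp])

/-- The cone of `r : X ⟶ X` is annihilated by `r ^ 2`. -/
theorem sq_smul_id_cone_eq_zero {X Y : T} {r : R} {f : X ⟶ Y} {g : Y ⟶ X⟦(1 : ℤ)⟧}
    (hT : Triangle.mk (r • 𝟙 X) f g ∈ distTriang T) : r ^ 2 • 𝟙 Y = 0 := by
  have hf : r • f = 0 := by
    have h : (r • 𝟙 X) ≫ f = 0 := comp_distTriang_mor_zero₁₂ _ hT
    rwa [Linear.smul_comp, Category.id_comp] at h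
  have hg : r • g = 0 := by
    have h : g ≫ (r • 𝟙 X)⟦(1 : ℤ)⟧' = 0 := comp_distTriang_mor_zero₃₁ _ hT
    rwa [Functor.map_smul, CategoryTheory.Functor.map_id, Linear.comp_smul, Category.comp_id] at h
  obtain ⟨φ, hφ⟩ : ∃ φ : X⟦(1 : ℤ)⟧ ⟶ Y, r • 𝟙 Y = g ≫ φ :=
    Triangle.yoneda_exact₃ _ hT (r • 𝟙 Y) (by
      change f ≫ (r • 𝟙 Y) = 0
      rw [Linear.comp_smul, Category.comp_id, hf])
  rw [pow_two, mul_smul, hφ, ← Linear.smul_comp, hg, zero_comp]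

theorem nonempty_retract_of_mor₁_eq_zero {D : Triangle T} (hD : D ∈ distTriang T) (h : D.mor₁ = 0) :
    Nonempty (Retract D.obj₂ D.obj₃) := by
  obtain ⟨s, hs⟩ := Triangle.yoneda_exact₂ D hD (𝟙 _) (by rw [h, zero_comp])
  exact ⟨⟨D.mor₂, s, hs.symm⟩⟩

end SmulTorsion

/-! ### Bounded complexes are built from their cohomology modules -/

section Devissage

variable (R : Type u) [CommRing R] [HasDerivedCategory.{w} (ModuleCat.{u} R)]

instance linear_homologyFunctor (i : ℤ) :
    (DerivedCategory.homologyFunctor (ModuleCat.{u} R) i).Linear R := by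
  have : (HomologicalComplex.homologyFunctor (ModuleCat.{u} R) (ComplexShape.up ℤ) i).Linear R :=
    ⟨fun f r => ShortComplex.homologyMap_smul
      ((HomologicalComplex.shortComplexFunctor _ _ i).map f) r⟩
  have : (DerivedCategory.Q ⋙ DerivedCategory.homologyFunctor (ModuleCat.{u} R) i).Linear R :=
    Functor.linear_of_iso _ (DerivedCategory.homologyFunctorFactors (ModuleCat.{u} R) i).symm
  let : Localization.Lifting DerivedCategory.Q
      (HomologicalComplex.quasiIso (ModuleCat.{u} R) (ComplexShape.up ℤ))
      (DerivedCategory.Q ⋙ DerivedCategory.homologyFunctor (ModuleCat.{u} R) i)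
      (DerivedCategory.homologyFunctor (ModuleCat.{u} R) i) := ⟨Iso.refl _⟩
  exact (Localization.functor_linear_iff DerivedCategory.Q
    (HomologicalComplex.quasiIso (ModuleCat.{u} R) (ComplexShape.up ℤ)) R
    (DerivedCategory.Q ⋙ DerivedCategory.homologyFunctor (ModuleCat.{u} R) i) _).1 inferInstance

variable {R}

theorem nonempty_iso_homology_mor₁ {T : Triangle (DerivedCategory (ModuleCat.{u} R))}
    (hT : T ∈ distTriang _) (i j : ℤ) (hij : i + 1 = j) (h₁ : IsZero (cohomology R T.obj₃ i))
    (h₂ : IsZero (cohomology R T.obj₃ j)) :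
    Nonempty (cohomology R T.obj₁ j ≅ cohomology R T.obj₂ j) := by
  have h1 := DerivedCategory.HomologySequence.exact₁ T hT i j hij
  have h2 := DerivedCategory.HomologySequence.exact₂ T hT j
  have := h1.mono_g (h₁.eq_of_src _ _)
  have := h2.epi_f (h₂.eq_of_tgt _ _)
  have : IsIso ((DerivedCategory.homologyFunctor _ j).map T.mor₁) := isIso_of_mono_of_epi _
  exact ⟨asIso ((DerivedCategory.homologyFunctor _ j).map T.mor₁)⟩

theorem nonempty_iso_homology_mor₂ {T : Triangle (DerivedCategory (ModuleCat.{u} R))}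
    (hT : T ∈ distTriang _) (i j : ℤ) (hij : i + 1 = j) (h₁ : IsZero (cohomology R T.obj₁ i))
    (h₂ : IsZero (cohomology R T.obj₁ j)) :
    Nonempty (cohomology R T.obj₂ i ≅ cohomology R T.obj₃ i) := by
  have h1 := DerivedCategory.HomologySequence.exact₂ T hT i
  have h2 := DerivedCategory.HomologySequence.exact₃ T hT i j hij
  have := h1.mono_g (h₁.eq_of_src _ _)
  have := h2.epi_f (h₂.eq_of_tgt _ _)
  have : IsIso ((DerivedCategory.homologyFunctor _ i).map T.mor₂) := isIso_of_mono_of_epi _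
  exact ⟨asIso ((DerivedCategory.homologyFunctor _ i).map T.mor₂)⟩

/-- A bounded complex belongs to every triangulated subcategory that contains its cohomology
modules. -/
theorem prop_of_prop_single_cohomology (P : ObjectProperty (DerivedCategory (ModuleCat.{u} R)))
    [P.IsTriangulated] [P.IsClosedUnderIsomorphisms] (a : ℤ) (n : ℕ)
    (X : DerivedCategory (ModuleCat.{u} R)) (hge : X.IsGE a) (hle : X.IsLE (a + n - 1))
    (h : ∀ i, P ((DerivedCategory.singleFunctor _ 0).obj (cohomology R X i))) : P X := by
  induction n generalizing X with
  | zero =>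
    exact P.prop_of_isZero (DerivedCategory.TStructure.t.isZero X (a + (0 : ℕ) - 1) a)
  | succ n ih =>
    obtain ⟨A, B, hA, hB, f, g, δ, hT⟩ :=
      DerivedCategory.TStructure.t.exists_triangle X (a + n - 1) (a + n) (by lia)
    have hA' : A.IsLE (a + n - 1) := ⟨hA⟩
    have hB' : B.IsGE (a + n) := ⟨hB⟩
    have hP0 {M N : ModuleCat.{u} R} (e : M ≅ N)
        (hN : P ((DerivedCategory.singleFunctor _ 0).obj N)) :
        P ((DerivedCategory.singleFunctor _ 0).obj M) :=
      P.prop_of_iso ((DerivedCategory.singleFunctor _ 0).mapIso e.symm) hN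
    have eA (i : ℤ) (hi : i < a + n) : Nonempty (cohomology R A i ≅ cohomology R X i) :=
      nonempty_iso_homology_mor₁ hT (i - 1) i (by lia)
        (B.isZero_of_isGE (a + n) _ (by lia)) (B.isZero_of_isGE (a + n) _ (by lia))
    have eB (i : ℤ) (hi : a + n ≤ i) : Nonempty (cohomology R X i ≅ cohomology R B i) :=
      nonempty_iso_homology_mor₂ hT i (i + 1) rfl
        (A.isZero_of_isLE (a + n - 1) _ (by lia)) (A.isZero_of_isLE (a + n - 1) _ (by lia))
    refine P.ext_of_isTriangulatedClosed₂ _ hT (ih A ?_ hA' fun i => ?_) ?_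
    · rw [DerivedCategory.isGE_iff]
      intro i hi
      obtain ⟨e⟩ := eA i (by lia)
      exact (X.isZero_of_isGE a i hi).of_iso e
    · by_cases hi : i < a + n
      · exact hP0 (eA i hi).some (h i)
      · exact P.prop_of_isZero (Functor.map_isZero _ (A.isZero_of_isLE (a + n - 1) i (by lia)))
    · have : B.IsLE (a + n) := by
        rw [DerivedCategory.isLE_iff]
        intro i hi
        obtain ⟨e⟩ := eB i (by lia)
        exact (X.isZero_of_isLE (a + (n + 1 : ℕ) - 1) i (by lia)).of_iso e.symm
      obtain ⟨Y, ⟨e⟩⟩ := B.exists_iso_singleFunctor_obj_of_isGE_of_isLE (a + n)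
      have eY : Y ≅ cohomology R X (a + n) :=
        ((DerivedCategory.singleFunctorCompHomologyFunctorIso _ (a + n)).app Y).symm ≪≫
          (DerivedCategory.homologyFunctor _ (a + n)).mapIso e.symm ≪≫ (eB _ le_rfl).some.symm
      have h0 := P.le_shift (-(a + n)) _ (hP0 eY (h _))
      exact P.prop_of_iso (((DerivedCategory.singleFunctors (ModuleCat.{u} R)).shiftIso
        (-(a + n)) (a + n) 0 (by lia)).app Y ≪≫ e.symm) h0

theorem exists_isGE_isLE_of_finiteCohomology {X : DerivedCategory (ModuleCat.{u} R)}
    (hX : finiteCohomology R X) : ∃ (a : ℤ) (n : ℕ), X.IsGE a ∧ X.IsLE (a + n - 1) := by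
  classical
  have : Module.Finite R (⨁ i : ℤ, cohomology R X i) := hX
  obtain ⟨s, hs⟩ := Module.Finite.fg_top (R := R) (M := ⨁ i : ℤ, cohomology R X i)
  let t : Finset ℤ := s.biUnion fun x => DFinsupp.support x
  have hzero (i : ℤ) (hi : i ∉ t) : IsZero (cohomology R X i) := by
    rw [ModuleCat.isZero_iff_subsingleton]
    refine subsingleton_of_forall_eq 0 fun y => ?_
    have hle : (⊤ : Submodule R (⨁ i : ℤ, cohomology R X i)) ≤
        LinearMap.ker (DirectSum.component R ℤ (fun i => cohomology R X i) i) := by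
      rw [← hs, Submodule.span_le]
      intro x hx
      by_contra hne
      exact hi (Finset.mem_biUnion.2 ⟨x, hx, DFinsupp.mem_support_iff.2 hne⟩)
    have := hle (trivial : DirectSum.lof R ℤ (fun i => cohomology R X i) i y ∈ ⊤)
    rwa [LinearMap.mem_ker, DirectSum.component.lof_self] at this
  have hN (i : ℤ) (hi : i ∈ t) : i.natAbs ≤ t.sup Int.natAbs := Finset.le_sup (f := Int.natAbs) hi
  refine ⟨-(t.sup Int.natAbs : ℕ), 2 * t.sup Int.natAbs + 1, ?_, ?_⟩
  · rw [DerivedCategory.isGE_iff]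
    exact fun i hi => hzero i fun hit => by have := hN i hit; lia
  · rw [DerivedCategory.isLE_iff]
    exact fun i hi => hzero i fun hit => by have := hN i hit; lia

theorem finite_cohomology {X : DerivedCategory (ModuleCat.{u} R)} (hX : finiteCohomology R X)
    (i : ℤ) : Module.Finite R (cohomology R X i) := by
  have : Module.Finite R (⨁ i : ℤ, cohomology R X i) := hX
  exact Module.Finite.of_surjective (DirectSum.component R ℤ (fun i => cohomology R X i) i)
    fun x => ⟨DirectSum.lof R ℤ (fun i => cohomology R X i) i x, by
      rw [DirectSum.component.lof_self]⟩

end Devissage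

/-! ### Finitely generated modules in the singularity category -/

section FiniteModules

variable (R : Type u) [CommRing R] [HasDerivedCategory.{w} (ModuleCat.{u} R)]

theorem finiteCohomology_single (M : ModuleCat.{u} R) [Module.Finite R M] :
    finiteCohomology R ((DerivedCategory.singleFunctor _ 0).obj M) := by
  refine finiteCohomology_of_degree_zero R _ ?_ fun i hi => ?_
  · exact Module.Finite.equiv (M := M)
      ((DerivedCategory.singleFunctorCompHomologyFunctorIso _ 0).app M).symm.toLinearEquiv
  · rcases lt_or_gt_of_ne hi with hi | hi
    · exact DerivedCategory.isZero_of_isGE _ 0 i hi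
    · exact DerivedCategory.isZero_of_isLE _ 0 i hi

theorem perfect_single (M : ModuleCat.{u} R) [Module.Finite R M] [Module.Projective R M] :
    perfect R ((DerivedCategory.singleFunctor _ 0).obj M) := by
  refine ⟨(CochainComplex.singleFunctor _ 0).obj M,
    ⟨fun i => ?_, fun i => ?_, 0, 0, fun i hi => ?_⟩,
    ⟨(DerivedCategory.singleFunctorIsoCompQ _ 0).app M⟩⟩
  · by_cases hi : i = 0
    · subst hi
      exact Module.Finite.equiv
        (HomologicalComplex.singleObjXSelf (ComplexShape.up ℤ) 0 M).symm.toLinearEquiv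
    · have := ModuleCat.subsingleton_of_isZero
        (HomologicalComplex.isZero_single_obj_X (ComplexShape.up ℤ) 0 M i hi)
      exact (inferInstance : Module.Finite R
        (((HomologicalComplex.single _ (ComplexShape.up ℤ) 0).obj M).X i))
  · by_cases hi : i = 0
    · subst hi
      exact Module.Projective.of_equiv
        (HomologicalComplex.singleObjXSelf (ComplexShape.up ℤ) 0 M).symm.toLinearEquiv
    · have := ModuleCat.subsingleton_of_isZero
        (HomologicalComplex.isZero_single_obj_X (ComplexShape.up ℤ) 0 M i hi)
      exact (inferInstance : Module.Projective R
        (((HomologicalComplex.single _ (ComplexShape.up ℤ) 0).obj M).X i))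
  · exact HomologicalComplex.isZero_single_obj_X (ComplexShape.up ℤ) 0 M i (by lia)

/-- A finitely generated module, as an object of `D^f(R)` concentrated in degree `0`. -/
noncomputable abbrev fgSingle (M : ModuleCat.{u} R) [Module.Finite R M] : Df R :=
  ⟨(DerivedCategory.singleFunctor _ 0).obj M, finiteCohomology_single R M⟩

variable {R} in
/-- The isomorphism closure of `P` in `D(R)` adds no object of `D^f(R)`. It turns closure
properties of `P` into ones about triangles of `D(R)`. -/
theorem prop_map_ι_iff (P : ObjectProperty (Df R)) [P.IsClosedUnderIsomorphisms] (X : Df R) :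
    P.map (finiteCohomology R).ι X.obj ↔ P X := by
  rw [ObjectProperty.prop_map_iff]
  refine ⟨fun ⟨Y, hY, ⟨e⟩⟩ => P.prop_of_iso ((finiteCohomology R).isoMk e) hY,
    fun h => ⟨X, h, ⟨Iso.refl _⟩⟩⟩

variable [IsNoetherianRing R]

instance linear_shiftFunctor_Df (n : ℤ) : (shiftFunctor (Df R) n).Linear R where
  map_smul {X Y} f r := by
    apply (finiteCohomology R).ι.map_injective
    rw [← cancel_mono (((finiteCohomology R).ι.commShiftIso n).hom.app Y)]
    have h1 := ((finiteCohomology R).ι.commShiftIso n).hom.naturality f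
    have h2 := ((finiteCohomology R).ι.commShiftIso n).hom.naturality (r • f)
    dsimp only [Functor.comp_map] at h1 h2
    rw [h2, Functor.map_smul (finiteCohomology R).ι, Functor.map_smul, Functor.map_smul,
      Linear.smul_comp, Linear.comp_smul, h1]

variable {R}

theorem prop_of_prop_fgSingle_cohomology (P : ObjectProperty (Df R)) [P.IsTriangulated]
    [P.IsClosedUnderIsomorphisms] (X : Df R)
    (h : ∀ i (_ : Module.Finite R (cohomology R X.obj i)),
      P (fgSingle R (cohomology R X.obj i))) : P X := by
  obtain ⟨a, n, hge, hle⟩ := exists_isGE_isLE_of_finiteCohomology X.property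
  refine (prop_map_ι_iff P X).1 (prop_of_prop_single_cohomology _ a n _ hge hle fun i => ?_)
  have := finite_cohomology X.property i
  exact (prop_map_ι_iff P (fgSingle R _)).2 (h i this)

section ShortExact

variable (P : ObjectProperty (Df R)) [P.IsTriangulated] [P.IsClosedUnderIsomorphisms]
  {S : ShortComplex (ModuleCat.{u} R)} [Module.Finite R S.X₁] [Module.Finite R S.X₂]
  [Module.Finite R S.X₃]

theorem prop_fgSingle_X₂_of_shortExact (hS : S.ShortExact) (h₁ : P (fgSingle R S.X₁))
    (h₃ : P (fgSingle R S.X₃)) : P (fgSingle R S.X₂) :=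
  (prop_map_ι_iff P _).1 ((P.map (finiteCohomology R).ι).ext_of_isTriangulatedClosed₂ _
    hS.singleTriangle_distinguished ((prop_map_ι_iff P _).2 h₁) ((prop_map_ι_iff P _).2 h₃))

theorem prop_fgSingle_X₃_of_shortExact (hS : S.ShortExact) (h₁ : P (fgSingle R S.X₁))
    (h₂ : P (fgSingle R S.X₂)) : P (fgSingle R S.X₃) :=
  (prop_map_ι_iff P _).1 ((P.map (finiteCohomology R).ι).ext_of_isTriangulatedClosed₃ _
    hS.singleTriangle_distinguished ((prop_map_ι_iff P _).2 h₁) ((prop_map_ι_iff P _).2 h₂))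

end ShortExact

theorem isZero_quotientFunctor_obj {X : Df R} (hX : perf R X) :
    IsZero ((quotientFunctor R).obj X) := by
  have h : (perf R).trW (0 : 0 ⟶ X) := .mk _ (contractible_distinguished₁ X) hX
  have := Localization.inverts (quotientFunctor R) (perf R).trW _ h
  exact (Functor.map_isZero _ (isZero_zero _)).of_iso
    (asIso ((quotientFunctor R).map (0 : 0 ⟶ X))).symm

theorem isZero_quotientFunctor_fgSingle (M : ModuleCat.{u} R) [Module.Finite R M]
    [Module.Projective R M] : IsZero ((quotientFunctor R).obj (fgSingle R M)) :=
  isZero_quotientFunctor_obj (perfect_single R M)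

-- Recorded so that instance search for `smulTorsion` in `D_sg(R)` finds it.
instance linear_shiftFunctor_Dsg (n : ℤ) : (shiftFunctor (Dsg R) n).Linear R :=
  inferInstance

/-- The class of objects of `D^f(R)` that some element of `S` annihilates in `D_sg(R)`. -/
abbrev singularSmulTorsion (S : Submonoid R) : ObjectProperty (Df R) :=
  (smulTorsion S).inverseImage (quotientFunctor R)

/-- By induction on the projective dimension of the localized module: free modules vanish in
`D_sg(R)`, so a module and its first syzygy differ there by a shift, and a module with projective
localization is, up to multiplication by an element of `S`, a summand of a free one. -/
theorem singularSmulTorsion_fgSingle (S : Submonoid R) (n : ℕ) (M : ModuleCat.{u} R)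
    [Module.Finite R M] (h : HasProjectiveDimensionLE (M.localizedModule S) n) :
    singularSmulTorsion S (fgSingle R M) := by
  induction n generalizing M with
  | zero =>
    have hM : Module.Projective (Localization S) (M.localizedModule S) := by
      rw [IsProjective.iff_projective]
      exact (projective_iff_hasProjectiveDimensionLE_zero _).2 h
    obtain ⟨r, hr, F, _, _, _, _, i, p, hip⟩ :=
      exists_smul_id_factors_of_projective_localizedModule S M hM
    refine ⟨r, hr, ?_⟩
    have h0 := isZero_quotientFunctor_fgSingle (ModuleCat.of R F)
    let i' : fgSingle R M ⟶ fgSingle R (ModuleCat.of R F) :=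
      ObjectProperty.homMk ((DerivedCategory.singleFunctor _ 0).map (ModuleCat.ofHom i))
    let p' : fgSingle R (ModuleCat.of R F) ⟶ fgSingle R M :=
      ObjectProperty.homMk ((DerivedCategory.singleFunctor _ 0).map (ModuleCat.ofHom p))
    have hip' : i' ≫ p' = r • 𝟙 _ := by
      apply (finiteCohomology R).ι.map_injective
      have : ModuleCat.ofHom i ≫ ModuleCat.ofHom p = r • 𝟙 M := by
        rw [← ModuleCat.ofHom_comp, hip]
        rfl
      rw [Functor.map_smul, Functor.map_comp, CategoryTheory.Functor.map_id]
      refine ((DerivedCategory.singleFunctor _ 0).map_comp _ _).symm.trans ?_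
      rw [this, Functor.map_smul, CategoryTheory.Functor.map_id]
      rfl
    rw [← CategoryTheory.Functor.map_id, ← Functor.map_smul, ← hip', Functor.map_comp,
      h0.eq_of_tgt ((quotientFunctor R).map i') 0, zero_comp]
  | succ n ih =>
    obtain ⟨F, _, _, _, _, f, hf⟩ := Module.exists_finite_presentation R M
    have hE := LinearMap.shortExact_shortComplexKer hf
    have hF : Projective (ModuleCat.of R F) :=
      ModuleCat.projective_of_free (Module.Free.chooseBasis R F)
    have hE' := hE.map_of_exact (ModuleCat.localizedModuleFunctor.{u} S)
    have hK := (hE'.hasProjectiveDimensionLT_X₃_iff n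
      ((ModuleCat.localizedModuleFunctor.{u} S).projective_obj_of_projective hF)).1 h
    have : Module.Finite R f.shortComplexKer.X₁ :=
      (inferInstance : Module.Finite R (LinearMap.ker f))
    have : Module.Finite R f.shortComplexKer.X₂ := (inferInstance : Module.Finite R F)
    have : Module.Finite R f.shortComplexKer.X₃ := (inferInstance : Module.Finite R M)
    refine prop_fgSingle_X₃_of_shortExact _ hE
      (ih (ModuleCat.of R (LinearMap.ker f)) hK) ?_
    exact (smulTorsion S).prop_of_isZero (isZero_quotientFunctor_fgSingle (ModuleCat.of R F))

end FiniteModules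

/-! ### Isolated singularities: the residue field generates -/

section Annihilators

variable {R : Type*} [CommRing R] {T : Type*} [Category* T] [Preadditive T] [Linear R T]

/-- The annihilator of an object of an `R`-linear category: the elements of `R` that act on it
as zero. -/
def objectAnnihilator (R : Type*) [CommRing R] {T : Type*} [Category* T] [Preadditive T]
    [Linear R T] (X : T) : Ideal R :=
  LinearMap.ker (LinearMap.toSpanSingleton R (X ⟶ X) (𝟙 X))

theorem mem_objectAnnihilator {X : T} {r : R} : r ∈ objectAnnihilator R X ↔ r • 𝟙 X = 0 := Iff.rfl

theorem mem_radical_objectAnnihilator {X : T} {r : R} :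
    r ∈ (objectAnnihilator R X).radical ↔ smulTorsion (Submonoid.powers r) X :=
  ⟨fun ⟨n, hn⟩ => ⟨r ^ n, ⟨n, rfl⟩, hn⟩, fun ⟨_, ⟨n, hn⟩, h⟩ => ⟨n, by
    subst hn; exact h⟩⟩

end Annihilators

section IsolatedSingularity

open IsLocalRing

variable {R : Type u} [CommRing R] [IsNoetherianRing R] [HasDerivedCategory.{w} (ModuleCat.{u} R)]

theorem singularSmulTorsion_of_isRegularLocalRing (p : Ideal R) [p.IsPrime]
    [IsRegularLocalRing (Localization.AtPrime p)] (X : Df R) :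
    singularSmulTorsion p.primeCompl X := by
  refine prop_of_prop_fgSingle_cohomology _ X fun i _ => ?_
  let M := cohomology R X.obj i
  have : IsLocalizedModule p.primeCompl (M.localizedModuleMkLinearMap p.primeCompl) :=
    ModuleCat.localizedModule_isLocalizedModule _ _
  have : Module.Finite (Localization.AtPrime p) (M.localizedModule p.primeCompl) :=
    Module.Finite.of_isLocalizedModule p.primeCompl (M.localizedModuleMkLinearMap p.primeCompl)
  obtain ⟨n, hn⟩ := exists_hasProjectiveDimensionLE_of_isRegularLocalRing
    (S := Localization.AtPrime p) (M.localizedModule p.primeCompl)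
  exact singularSmulTorsion_fgSingle p.primeCompl n M hn

/-- The annihilator of an object of `D_sg(R)` lies in no nonmaximal prime. -/
theorem maximalIdeal_le_radical_objectAnnihilator [IsLocalRing R] (h : HasIsolatedSingularity R)
    (X : Df R) : maximalIdeal R ≤ (objectAnnihilator R ((quotientFunctor R).obj X)).radical := by
  rw [Ideal.radical_eq_sInf]
  refine le_sInf fun p ⟨hp, hpp⟩ => ?_
  by_cases hpm : p = maximalIdeal R
  · exact hpm.ge
  · have := h p hpm
    obtain ⟨r, hr, h0⟩ := singularSmulTorsion_of_isRegularLocalRing p X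
    exact (hr (hp h0)).elim

/-- If every element of the finite set `s` acts nilpotently on all objects of `D_sg(R)`, then every
object of `D^f(R)` is, in `D_sg(R)`, a direct summand of one on which the elements of `s`
act nilpotently already in `D^f(R)`: an iterated cone on powers of the elements of `s`. -/
theorem exists_retract_smulTorsion (s : Finset R)
    (h : ∀ (X : Df R), ∀ r ∈ s, smulTorsion (Submonoid.powers r) ((quotientFunctor R).obj X))
    (X : Df R) : ∃ Y : Df R,
      Nonempty (Retract ((quotientFunctor R).obj X) ((quotientFunctor R).obj Y)) ∧
        ∀ r ∈ s, smulTorsion (Submonoid.powers r) Y := by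
  classical
  induction s using Finset.induction_on with
  | empty => exact ⟨X, ⟨Retract.refl _⟩, by simp⟩
  | insert r s hrs ih =>
    obtain ⟨Y, ⟨ρ⟩, hY⟩ := ih fun X r hr => h X r (Finset.mem_insert_of_mem hr)
    obtain ⟨t, ht, h0⟩ := h Y r (Finset.mem_insert_self _ _)
    obtain ⟨Z, f, g, hT⟩ := distinguished_cocone_triangle (t • 𝟙 Y)
    have hQ := (quotientFunctor R).map_distinguished _ hT
    obtain ⟨σ⟩ := nonempty_retract_of_mor₁_eq_zero hQ (by
      change (quotientFunctor R).map (t • 𝟙 Y) = 0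
      rw [Functor.map_smul, CategoryTheory.Functor.map_id, h0])
    refine ⟨Z, ⟨ρ.trans σ⟩, fun r' hr' => ?_⟩
    rcases Finset.mem_insert.1 hr' with rfl | hr'
    · exact ⟨t ^ 2, pow_mem ht 2, sq_smul_id_cone_eq_zero hT⟩
    · exact ObjectProperty.ext_of_isTriangulatedClosed₃ _ _ hT (hY r' hr') (hY r' hr')

variable [IsLocalRing R]

/-- A finitely generated module on which the elements of the maximal ideal act nilpotently has a
finite filtration with subquotients `k`. -/
theorem prop_fgSingle_of_nilpotent_smul (P : ObjectProperty (Df R)) [P.IsTriangulated]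
    [P.IsClosedUnderIsomorphisms]
    (hP : P ⟨residueFieldComplex R, finiteCohomology_residueFieldComplex R⟩)
    (M : Type u) [AddCommGroup M] [Module R M] (hM : Module.Finite R M)
    (h : ∀ r ∈ maximalIdeal R, ∃ n : ℕ, ∀ x : M, r ^ n • x = 0) :
    P (fgSingle R (ModuleCat.of R M)) := by
  induction hM using IsNoetherianRing.induction_on_isQuotientEquivQuotientPrime R with
  | subsingleton N =>
    refine (prop_map_ι_iff P _).1 (ObjectProperty.prop_of_isZero _ ?_)
    exact (DerivedCategory.singleFunctor (ModuleCat.{u} R) 0).map_isZero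
      (ModuleCat.isZero_of_subsingleton (ModuleCat.of R N))
  | quotient N p e =>
    have hp : p.1 = maximalIdeal R := by
      refine le_antisymm (le_maximalIdeal p.2.ne_top) fun r hr => ?_
      obtain ⟨n, hn⟩ := h r hr
      refine p.2.mem_of_pow_mem n ?_
      have := congrArg e (hn (e.symm (Ideal.Quotient.mk p.1 1)))
      rw [map_smul, e.apply_symm_apply, map_zero] at this
      rw [← Ideal.Quotient.eq_zero_iff_mem, ← mul_one (r ^ n)]
      exact this
    have e' : N ≃ₗ[R] ResidueField R := e.trans (Submodule.quotEquivOfEq _ _ hp)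
    exact P.prop_of_iso ((finiteCohomology R).isoMk
      ((DerivedCategory.singleFunctor _ 0).mapIso e'.symm.toModuleIso)) hP
  | exact N₁ N₂ N₃ f g hf hg hfg h₁ h₃ =>
    have h₁' := h₁ fun r hr => by
      obtain ⟨n, hn⟩ := h r hr
      exact ⟨n, fun x => hf (by rw [map_smul, hn, map_zero])⟩
    have h₃' := h₃ fun r hr => by
      obtain ⟨n, hn⟩ := h r hr
      refine ⟨n, fun x => ?_⟩
      obtain ⟨y, rfl⟩ := hg x
      rw [← map_smul, hn, map_zero]
    let S : ShortComplex (ModuleCat.{u} R) :=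
      ShortComplex.mk (ModuleCat.ofHom f) (ModuleCat.ofHom g) (by
        ext x
        exact hfg.apply_apply_eq_zero x)
    have hS : S.ShortExact :=
      { exact := (ShortComplex.ShortExact.moduleCat_exact_iff_function_exact S).2 hfg
        mono_f := (ModuleCat.mono_iff_injective _).2 hf
        epi_g := (ModuleCat.epi_iff_surjective _).2 hg }
    have : Module.Finite R S.X₁ := (inferInstance : Module.Finite R N₁)
    have : Module.Finite R S.X₂ := (inferInstance : Module.Finite R N₂)
    have : Module.Finite R S.X₃ := (inferInstance : Module.Finite R N₃)
    exact prop_fgSingle_X₂_of_shortExact P hS h₁' h₃'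

theorem prop_of_maximalIdeal_le_radical_objectAnnihilator (P : ObjectProperty (Df R))
    [P.IsTriangulated] [P.IsClosedUnderIsomorphisms]
    (hP : P ⟨residueFieldComplex R, finiteCohomology_residueFieldComplex R⟩) (Y : Df R)
    (hY : maximalIdeal R ≤ (objectAnnihilator R Y).radical) : P Y := by
  refine prop_of_prop_fgSingle_cohomology P Y fun i hi =>
    prop_fgSingle_of_nilpotent_smul P hP _ hi fun r hr => ?_
  obtain ⟨n, hn⟩ := hY hr
  refine ⟨n, fun x => ?_⟩
  have h1 : r ^ n • 𝟙 Y.obj = 0 := (finiteCohomology R).ι.congr_map (mem_objectAnnihilator.1 hn)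
  have h2 := congrArg (DerivedCategory.homologyFunctor (ModuleCat.{u} R) i).map h1
  rw [Functor.map_smul, CategoryTheory.Functor.map_id, Functor.map_zero] at h2
  exact LinearMap.congr_fun (congrArg ModuleCat.Hom.hom h2) x

theorem thick_residueField_eq_top (h : HasIsolatedSingularity R) :
    thick (residueField R) = ⊤ := by
  obtain ⟨s, hs⟩ := IsNoetherian.noetherian (maximalIdeal R)
  rw [eq_top_iff]
  intro X _
  let e := (quotientFunctor R).objObjPreimageIso X
  refine ObjectProperty.prop_of_iso _ e ?_
  obtain ⟨Y, ⟨ρ⟩, hY⟩ := exists_retract_smulTorsion s (fun Z r hr =>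
    mem_radical_objectAnnihilator.1 (maximalIdeal_le_radical_objectAnnihilator h Z
      (hs ▸ Ideal.subset_span hr))) ((quotientFunctor R).objPreimage X)
  refine ObjectProperty.prop_of_retract _ ρ ?_
  refine prop_of_maximalIdeal_le_radical_objectAnnihilator
    ((thick (residueField R)).inverseImage (quotientFunctor R)) ?_ Y ?_
  · exact ObjectProperty.le_triangEnvelope _ _ ((ObjectProperty.singleton_iff _ _).2 rfl)
  · rw [← hs]
    exact Ideal.span_le.2 fun r hr => mem_radical_objectAnnihilator.2 (hY r hr)

end IsolatedSingularity

/-! ### Generation by the residue field forces regularity on the punctured spectrum -/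

section ThickResidueField

open IsLocalRing Abelian

variable {R : Type u} [CommRing R] [HasDerivedCategory.{w} (ModuleCat.{u} R)]

/-- A perfect complex has no nonzero morphisms to modules shifted far enough. -/
theorem exists_forall_hom_shift_eq_zero_of_perfect {P : DerivedCategory (ModuleCat.{u} R)}
    (hP : perfect R P) : ∃ b : ℤ, ∀ n > b, ∀ (L : ModuleCat.{u} R)
      (g : P ⟶ ((DerivedCategory.singleFunctor _ 0).obj L)⟦n⟧), g = 0 := by
  obtain ⟨K, hK, ⟨e⟩⟩ := hP
  obtain ⟨a, _, ha⟩ := hK.bounded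
  refine ⟨-a, fun n hn L g => ?_⟩
  let L' : CochainComplex (ModuleCat.{u} R) ℤ := (CochainComplex.singleFunctor _ (-n)).obj L
  let e' : ((DerivedCategory.singleFunctor _ 0).obj L)⟦n⟧ ≅ DerivedCategory.Q.obj L' :=
    ((DerivedCategory.singleFunctors (ModuleCat.{u} R)).shiftIso n (-n) 0 (by lia)).app L ≪≫
      (DerivedCategory.singleFunctorIsoCompQ _ (-n)).app L
  have hzero (f : K ⟶ L') : f = 0 := by
    ext1 i
    by_cases hi : i = -n
    · exact (ha i (Or.inl (by lia))).eq_of_src _ _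
    · exact (HomologicalComplex.isZero_single_obj_X (ComplexShape.up ℤ) (-n) L i hi).eq_of_tgt _ _
  have hQ (φ : DerivedCategory.Q.obj K ⟶ DerivedCategory.Q.obj L') : φ = 0 := by
    have := hK.isKProjective
    obtain ⟨ψ, hψ⟩ := (CochainComplex.IsKProjective.Qh_map_bijective K
      ((HomotopyCategory.quotient _ _).obj L')).surjective
        ((DerivedCategory.quotientCompQhIso _).hom.app K ≫ φ ≫
          (DerivedCategory.quotientCompQhIso _).inv.app L')
    obtain ⟨f, rfl⟩ := (HomotopyCategory.quotient _ _).map_surjective ψ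
    rw [hzero f, Functor.map_zero, Functor.map_zero] at hψ
    rw [← cancel_epi ((DerivedCategory.quotientCompQhIso _).hom.app K),
      ← cancel_mono ((DerivedCategory.quotientCompQhIso _).inv.app L'), Category.assoc, ← hψ]
    simp
  rw [← cancel_epi e.inv, ← cancel_mono e'.hom, hQ (_ ≫ _), comp_zero, zero_comp]

variable [IsNoetherianRing R]

theorem exists_factors_through_perfect {X Y : Df R} (f : X ⟶ Y)
    (hf : (quotientFunctor R).map f = 0) :
    ∃ (P : Df R) (_ : perf R P) (i : X ⟶ P) (p : P ⟶ Y), f = i ≫ p := by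
  rw [← Functor.map_zero (quotientFunctor R),
    MorphismProperty.map_eq_iff_postcomp (quotientFunctor R) (perf R).trW] at hf
  obtain ⟨Z, s, hs, h⟩ := hf
  obtain ⟨P, p, δ, hT, hP⟩ := ((perf R).trW_iff' s).1 hs
  obtain ⟨i, hi⟩ := Triangle.coyoneda_exact₂ _ hT f (by
    change f ≫ s = 0
    rw [h, zero_comp])
  exact ⟨P, hP, i, p, hi⟩

/-- An element that annihilates `M` in `D_sg(R)` annihilates the functor `Extⁿ⁺¹(M, -)` for some `n`:
multiplication by it on `M` factors through a perfect complex. -/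
theorem exists_forall_smul_ext_eq_zero (M : ModuleCat.{u} R) [Module.Finite R M] {r : R}
    (h : r • 𝟙 ((quotientFunctor R).obj (fgSingle R M)) = 0) :
    ∃ n : ℕ, ∀ (L : ModuleCat.{u} R) (e : Ext M L (n + 1)), r • e = 0 := by
  rw [← CategoryTheory.Functor.map_id, ← Functor.map_smul] at h
  obtain ⟨P, hP, i, p, hip⟩ := exists_factors_through_perfect _ h
  obtain ⟨b, hb⟩ := exists_forall_hom_shift_eq_zero_of_perfect hP
  refine ⟨b.toNat, fun L e => ?_⟩
  apply (Ext.homLinearEquiv (R := R) (X := M) (Y := L) (n := b.toNat + 1)).injective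
  rw [map_smul, map_zero]
  have hip' : r • 𝟙 _ = i.hom ≫ p.hom := (finiteCohomology R).ι.congr_map hip
  generalize Ext.homLinearEquiv (R := R) e = g
  rw [← Category.id_comp g]
  change r • (𝟙 _ ≫ g) = 0
  rw [← Linear.smul_comp, hip', Category.assoc, hb _ (by lia) L (p.hom ≫ g), comp_zero]

variable [IsLocalRing R]

theorem smul_id_residueField_eq_zero {r : R} (hr : r ∈ maximalIdeal R) :
    r • 𝟙 (residueField R) = 0 := by
  have h : r • 𝟙 (ModuleCat.of R (ResidueField R)) = 0 := by
    ext x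
    obtain ⟨x, rfl⟩ := residue_surjective x
    change r • residue R x = 0
    rw [Algebra.smul_def]
    change residue R r * _ = 0
    rw [(residue_eq_zero_iff r).2 hr, zero_mul]
  have h' : r • 𝟙 (⟨residueFieldComplex R, finiteCohomology_residueFieldComplex R⟩ : Df R) = 0 := by
    apply (finiteCohomology R).ι.map_injective
    have := congrArg (DerivedCategory.singleFunctor (ModuleCat.{u} R) 0).map h
    rwa [Functor.map_smul, CategoryTheory.Functor.map_id, Functor.map_zero] at this
  have := congrArg (quotientFunctor R).map h'
  rwa [Functor.map_smul, CategoryTheory.Functor.map_id, Functor.map_zero] at this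

theorem hasIsolatedSingularity_of_thick_residueField_eq_top (h : thick (residueField R) = ⊤) :
    HasIsolatedSingularity R := by
  intro p _ hp
  have hpm : p < maximalIdeal R := (le_maximalIdeal ‹p.IsPrime›.ne_top).lt_of_ne hp
  obtain ⟨r, hrm, hrp⟩ := SetLike.exists_of_lt hpm
  have hle : thick (residueField R) ≤ smulTorsion p.primeCompl := by
    rw [ObjectProperty.triangEnvelope_le_iff, ObjectProperty.singleton_le_iff]
    exact ⟨r, hrp, smul_id_residueField_eq_zero hrm⟩
  have : Module.Finite R (ModuleCat.of R (R ⧸ p)) := (inferInstance : Module.Finite R (R ⧸ p))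
  obtain ⟨t, ht, h0⟩ := hle ((quotientFunctor R).obj (fgSingle R (ModuleCat.of R (R ⧸ p)))) (by
    rw [h]; trivial)
  obtain ⟨n, hn⟩ := exists_forall_smul_ext_eq_zero _ h0
  have hpd := hasProjectiveDimensionLE_localizedModule_of_smul_ext_eq_zero p.primeCompl ht n _ hn
  obtain ⟨e⟩ := nonempty_localizedModule_quotient_iso_residueField p
  exact isRegularLocalRing_of_hasProjectiveDimensionLE n
    (hasProjectiveDimensionLT_of_iso e (n + 1))

end ThickResidueField

end SingularityCategory

theorem mainTheorem7 (R : Type u) [CommRing R] [IsNoetherianRing R] [IsLocalRing R]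
    [HasDerivedCategory.{w} (ModuleCat.{u} R)] :
    SingularityCategory.HasIsolatedSingularity R ↔
      SingularityCategory.thick (SingularityCategory.residueField R) = ⊤ :=
  ⟨SingularityCategory.thick_residueField_eq_top,
    SingularityCategory.hasIsolatedSingularity_of_thick_residueField_eq_top⟩
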